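/- Let $m\ge 1$, $1\le k\le n$ and $b\ge 1$ be integers with $m\le \frac{n\log m}{k}$ (logarithms to base 2). Let $A$ be a random $m\times n$ 0-1 matrix in which each row, independently of the others, has exactly $k$ ones, in a uniformly random set of $k$ columns. There is an absolute constant $\gamma>0$ such that for every $a\in\mathbb N$, with probability at least $1-m^{-a}$ over $A$, the following holds for every real $p\ge 1$, every weight vector $c$ with $\frac1p\le c_i\le 1$ for all $i$, and every $x'\in[0,1]^n$ that maximizes $\sum_i c_ix_i$ over all $x\in[0,1]^n$ with $Ax\le b$ (coordinatewise); write $\mathrm{OPT}=\sum_i c_ix'_i$. There is $\hat x\in\{0,1\}^n$ with $$\|A\hat x\|_\infty\le b\qquad\text{and}\qquad \sum_i c_i\hat x_i\ \ge\ \gamma\cdot\frac{\mathrm{OPT}}{\max(p\log m,\ \log^2 m)^{1/b}}.$$ Moreover such an $\hat x$ can be computed in randomized polynomial time: for every $a$ there is a randomized algorithm (a probabilistic random access machine with logarithmic cost), depending only on $a$, that on every input $(A,b,c,x')$ with rational $c,x'$ halts, for all outcomes of its random bits, within time polynomial in the bit length of the input, and that for $A$, $c$, $x'$ as above with $c$,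 $x'$ rational outputs such an $\hat x$ with probability at least $1-m^{-a}$ over its random bits. -/

import Mathlib

open scoped Matrix NNRat

namespace PackingRounding

/-! ### Uniform probability on a finite set -/

open Classical in
/-- The probability of the event `E` under the uniform distribution on a finite type. -/
noncomputable def uniformProb {Ω : Type} [Fintype Ω] (E : Ω → Prop) : ℝ :=
  ((Finset.univ.filter E).card : ℝ) / (Fintype.card Ω : ℝ)

/-! ### Random matrices with `k` ones per row -/

/-- The sample space of the random `m × n` matrices with exactly `k` ones per row: each row chooses
the set of its `k` columns. The uniform distribution on this finite product is the distribution
under which the rows are independent and each is uniform among the `k`-subsets of the columns. -/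
abbrev RowChoice (m n k : ℕ) : Type := Fin m → {s : Finset (Fin n) // s.card = k}

/-- The row supports of a matrix in the family. -/
def RowChoice.supports {m n k : ℕ} (R : RowChoice m n k) : Fin m → Finset (Fin n) :=
  fun j => (R j).1

/-- The 0-1 matrix whose `j`-th row is the indicator vector of `S j`. -/
def zeroOneMatrix {m n : ℕ} (S : Fin m → Finset (Fin n)) : Matrix (Fin m) (Fin n) ℝ :=
  Matrix.of fun j i => if i ∈ S j then 1 else 0

/-! ### The packing program and its roundings -/

/-- The polytope `{z ∈ [0,1]ⁿ : A z ≤ b}`. -/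
def packingPolytope {m n : ℕ} (A : Matrix (Fin m) (Fin n) ℝ) (b : ℕ) : Set (Fin n → ℝ) :=
  {z | (∀ i, 0 ≤ z i ∧ z i ≤ 1) ∧ ∀ j, (A *ᵥ z) j ≤ (b : ℝ)}

/-- `x` is an optimal solution of the linear program: maximize `c ⬝ᵥ z` over the polytope. -/
def IsLPOptimal {m n : ℕ} (A : Matrix (Fin m) (Fin n) ℝ) (b : ℕ) (c x : Fin n → ℝ) : Prop :=
  x ∈ packingPolytope A b ∧ IsMaxOn (fun z => c ⬝ᵥ z) (packingPolytope A b) x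

/-- The factor `max (p log m, log² m) ^ (1/b)`, with logarithms to base 2. -/
noncomputable def approxFactor (m b : ℕ) (p : ℝ) : ℝ :=
  (max (p * Real.logb 2 m) (Real.logb 2 m ^ 2)) ^ (1 / (b : ℝ))

/-- `y` is a 0-1 vector with `‖A y‖_∞ ≤ b` (the norm of `Fin m → ℝ` is the maximum norm) and
objective value at least `γ · OPT / max (p log m, log² m) ^ (1/b)`, where `OPT = c ⬝ᵥ x`. -/
def IsGoodRounding {m n : ℕ} (γ : ℝ) (A : Matrix (Fin m) (Fin n) ℝ) (b : ℕ) (p : ℝ)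
    (c x y : Fin n → ℝ) : Prop :=
  (∀ i, y i = 0 ∨ y i = 1) ∧ ‖A *ᵥ y‖ ≤ (b : ℝ) ∧
    γ * (c ⬝ᵥ x / approxFactor m b p) ≤ c ⬝ᵥ y

/-! ### Probabilistic random access machines with logarithmic cost

A program works on finitely many arrays (array number `a`, index `i`) whose cells hold natural
numbers. Every elementary operation costs one plus the bit length of the number it produces, so that
the cost of a run is polynomially related to the running time of a Turing machine. -/

/-- Expressions. Subtraction is truncated and division rounds down (with `x / 0 = 0`). -/
inductive Expr : Type
  | lit (v : ℕ)
  | get (a : ℕ) (i : Expr)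
  | add (e f : Expr)
  | sub (e f : Expr)
  | mul (e f : Expr)
  | div (e f : Expr)

/-- The value of an expression when the arrays have the contents `σ`. -/
def Expr.eval (σ : ℕ → ℕ → ℕ) : Expr → ℕ
  | .lit v => v
  | .get a i => σ a (i.eval σ)
  | .add e f => e.eval σ + f.eval σ
  | .sub e f => e.eval σ - f.eval σ
  | .mul e f => e.eval σ * f.eval σ
  | .div e f => e.eval σ / f.eval σ

/-- The cost of evaluating an expression: one plus the bit length of the value, summed over all
subexpressions. -/
def Expr.cost (σ : ℕ → ℕ → ℕ) : Expr → ℕ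
  | .lit v => 1 + v.size
  | .get a i => i.cost σ + (1 + (σ a (i.eval σ)).size)
  | .add e f => e.cost σ + f.cost σ + (1 + (e.eval σ + f.eval σ).size)
  | .sub e f => e.cost σ + f.cost σ + (1 + (e.eval σ - f.eval σ).size)
  | .mul e f => e.cost σ + f.cost σ + (1 + (e.eval σ * f.eval σ).size)
  | .div e f => e.cost σ + f.cost σ + (1 + (e.eval σ / f.eval σ).size)

/-- Programs. `set a i e` writes the value of `e` into cell `i` of array `a`, `flip a i` writes a
random bit there; in `cond` and `loop` an expression counts as true if its value is not zero. -/
inductive Prog : Type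
  | skip
  | set (a : ℕ) (i e : Expr)
  | flip (a : ℕ) (i : Expr)
  | seq (P Q : Prog)
  | cond (e : Expr) (P Q : Prog)
  | loop (e : Expr) (P : Prog)

/-- A machine state: the contents of the arrays and the number of random bits used so far. -/
structure State : Type where
  arr : ℕ → ℕ → ℕ
  used : ℕ

/-- The array contents after writing `v` into cell `i` of array `a`. -/
def write (σ : ℕ → ℕ → ℕ) (a i v : ℕ) : ℕ → ℕ → ℕ :=
  Function.update σ a (Function.update (σ a) i v)

/-- `Exec ω P s s' t`: with the sequence `ω` of random bits, the program `P` started in the state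
`s` halts in the state `s'` at the cost `t`. -/
inductive Exec (ω : ℕ → Bool) : Prog → State → State → ℕ → Prop
  | skip (s : State) : Exec ω .skip s s 1
  | set (s : State) (a : ℕ) (i e : Expr) :
      Exec ω (.set a i e) s ⟨write s.arr a (i.eval s.arr) (e.eval s.arr), s.used⟩
        (i.cost s.arr + e.cost s.arr + 1)
  | flip (s : State) (a : ℕ) (i : Expr) :
      Exec ω (.flip a i) s ⟨write s.arr a (i.eval s.arr) (ω s.used).toNat, s.used + 1⟩
        (i.cost s.arr + 1)
  | seq {P Q : Prog} {s s' s'' : State} {t t' : ℕ} (h : Exec ω P s s' t)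
      (h' : Exec ω Q s' s'' t') : Exec ω (.seq P Q) s s'' (t + t')
  | condTrue {e : Expr} {P Q : Prog} {s s' : State} {t : ℕ} (he : e.eval s.arr ≠ 0)
      (h : Exec ω P s s' t) : Exec ω (.cond e P Q) s s' (e.cost s.arr + 1 + t)
  | condFalse {e : Expr} {P Q : Prog} {s s' : State} {t : ℕ} (he : e.eval s.arr = 0)
      (h : Exec ω Q s s' t) : Exec ω (.cond e P Q) s s' (e.cost s.arr + 1 + t)
  | loopTrue {e : Expr} {P : Prog} {s s' s'' : State} {t t' : ℕ} (he : e.eval s.arr ≠ 0)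
      (h : Exec ω P s s' t) (h' : Exec ω (.loop e P) s' s'' t') :
      Exec ω (.loop e P) s s'' (e.cost s.arr + 1 + t + t')
  | loopFalse {e : Expr} {P : Prog} {s : State} (he : e.eval s.arr = 0) :
      Exec ω (.loop e P) s s (e.cost s.arr + 1)

/-- `T` random bits, continued by zeros. A run of cost at most `T` reads at most `T` bits. -/
def coins {T : ℕ} (r : Fin T → Bool) : ℕ → Bool :=
  fun i => if h : i < T then r ⟨i, h⟩ else false

/-! ### Inputs and outputs of a rounding algorithm -/

/-- An input with rational data: the row supports of a 0-1 matrix, the right-hand side, the weights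
and the fractional solution. -/
structure Input (m n : ℕ) : Type where
  supp : Fin m → Finset (Fin n)
  b : ℕ
  c : Fin n → ℚ≥0
  x : Fin n → ℚ≥0

/-- The length of an input: the number of matrix entries, rows and columns plus the bit lengths of
the numbers. -/
def Input.length {m n : ℕ} (I : Input m n) : ℕ :=
  m * n + m + n + I.b.size +
    ∑ i, ((I.c i).num.size + (I.c i).den.size + (I.x i).num.size + (I.x i).den.size)

/-- A finite list of numbers as the contents of an array. -/
def ofFin {n : ℕ} (v : Fin n → ℕ) : ℕ → ℕ :=
  fun i => if h : i < n then v ⟨i, h⟩ else 0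

/-- The initial contents of the arrays: array 0 holds `m, n, b`, array 1 the matrix (the entry in
row `j` and column `i` in cell `n * j + i`), arrays 2 and 3 the numerators and denominators of the
weights, arrays 4 and 5 those of the fractional solution; all other cells are zero. -/
def Input.load {m n : ℕ} (I : Input m n) : ℕ → ℕ → ℕ
  | 0 => ofFin ![m, n, I.b]
  | 1 => ofFin fun t : Fin (m * n) =>
      if (finProdFinEquiv.symm t).2 ∈ I.supp (finProdFinEquiv.symm t).1 then 1 else 0
  | 2 => ofFin fun i => (I.c i).num
  | 3 => ofFin fun i => (I.c i).den
  | 4 => ofFin fun i => (I.x i).num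
  | 5 => ofFin fun i => (I.x i).den
  | _ => fun _ => 0

/-- The output vector, read from array 6. -/
def State.output (s : State) (n : ℕ) : Fin n → ℝ :=
  fun i => (s.arr 6 i : ℝ)

/-- With the random bits `ω`, the program `P` halts on the input `I` at cost at most `T`, in a state
whose output vector satisfies `G`. -/
def RunsTo {m n : ℕ} (P : Prog) (I : Input m n) (T : ℕ) (ω : ℕ → Bool)
    (G : (Fin n → ℝ) → Prop) : Prop :=
  ∃ (s : State) (t : ℕ), Exec ω P ⟨I.load, 0⟩ s t ∧ t ≤ T ∧ G (s.output n)

/-- On every input and for all outcomes of the random bits, the program `P` halts at cost at most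
`q` of the length of the input. -/
def RunsInTime (P : Prog) (q : Polynomial ℕ) : Prop :=
  ∀ (m n : ℕ) (I : Input m n) (ω : ℕ → Bool), RunsTo P I (q.eval I.length) ω fun _ => True

end PackingRounding

/-!
The rounding is greedy: in a state `Y` every row charges each of its columns the price `β ^ load`,
and an available column of minimal `price / weight` is added. Let `Φ` be the sum of all charges and
`O` the value of the fractional solution `x`. As long as the columns of `Y` weigh less than
`O / (4 * β)`, at least half of `O` sits on available columns: `Y` itself covers at most a quarter,
and each of the at most `Φ / β ^ b` saturated rows blocks only a small share of `O`. Averaging over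
`x`, some available column `j` then has price at most `2 * b * Φ * c j / O`, so that adding it
multiplies `Φ` by at most `exp (2 * b * β * c j / O)`. Starting from `m`, the potential thus stays
below `m * exp (b / 2)`, which for `β ^ b` of order `exp (b / 2) * min m (p * d)` bounds the number
of saturated rows as needed; here `d` is such that `m * k ≤ d * n`. Since the procedure can only
stop when no column is available, it reaches the weight `O / (4 * β)`.

A suitable `β` is at most `8 * m`, hence the algorithm tries all integers up to this bound and keeps
the heaviest result. Neither the random bits nor the randomness of the matrix are needed: the
guarantee holds for every matrix with at most `k` ones per row.
-/

namespace PackingRounding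

/-! ### The greedy procedure -/

section Greedy

variable {R ι 𝕜 : Type*} [DecidableEq ι] {S : R → Finset ι} {Y : Finset ι} {b : ℕ} {i j : ι}

/-- The load of the row `r`: the number of columns of `Y` in its support. -/
def rowLoad (S : R → Finset ι) (Y : Finset ι) (r : R) : ℕ := (S r ∩ Y).card

theorem rowLoad_insert (hj : j ∉ Y) (r : R) :
    rowLoad S (insert j Y) r = rowLoad S Y r + if j ∈ S r then 1 else 0 := by
  by_cases hr : j ∈ S r
  · rw [rowLoad, Finset.inter_insert_of_mem hr, Finset.card_insert_of_notMem (by simp [hj])]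
    simp [rowLoad, hr]
  · simp [rowLoad, hr]

/-- The price of the column `i`: every row that contains it charges `β` to the power of its
load. -/
def price [Fintype R] [Semiring 𝕜] (S : R → Finset ι) (β : 𝕜) (Y : Finset ι) (i : ι) : 𝕜 :=
  ∑ r with i ∈ S r, β ^ rowLoad S Y r

/-- The potential function of the greedy procedure. -/
def potential [Fintype R] [Semiring 𝕜] (S : R → Finset ι) (β : 𝕜) (Y : Finset ι) : 𝕜 :=
  ∑ r, β ^ rowLoad S Y r

/-- The columns that the greedy procedure may add to `Y`. Columns of weight zero are excluded: they
are of no use, and comparisons of `price / weight` are then free of divisions by zero. -/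
def Available [Zero 𝕜] [LT 𝕜] (S : R → Finset ι) (b : ℕ) (c : ι → 𝕜) (Y : Finset ι) (i : ι) :
    Prop :=
  0 < c i ∧ i ∉ Y ∧ ∀ r, i ∈ S r → rowLoad S Y r < b

/-- The sets that arise by adding available columns of minimal `price / weight` one after the
other, with arbitrary tie-breaking. -/
inductive IsGreedy [Fintype R] [Semiring 𝕜] [LE 𝕜] [LT 𝕜] (S : R → Finset ι) (β : 𝕜) (b : ℕ)
    (c : ι → 𝕜) : Finset ι → Prop
  | empty : IsGreedy S β b c ∅
  | insert {Y : Finset ι} {j : ι} (hY : IsGreedy S β b c Y) (hj : Available S b c Y j)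
      (hmin : ∀ i, Available S b c Y i → c i * price S β Y j ≤ c j * price S β Y i) :
      IsGreedy S β b c (insert j Y)

/-- The possible results of the greedy procedure, run until no column is available. -/
structure IsMaximalGreedy [Fintype R] [Semiring 𝕜] [LE 𝕜] [LT 𝕜] (S : R → Finset ι) (β : 𝕜)
    (b : ℕ) (c : ι → 𝕜) (Y : Finset ι) : Prop where
  isGreedy : IsGreedy S β b c Y
  not_available : ∀ i, ¬Available S b c Y i

variable [Fintype R]

theorem IsGreedy.rowLoad_le [Semiring 𝕜] [LE 𝕜] [LT 𝕜] {β : 𝕜} {c : ι → 𝕜}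
    (hY : IsGreedy S β b c Y) (r : R) : rowLoad S Y r ≤ b := by
  induction hY with
  | empty => simp [rowLoad]
  | insert _ hj _ ih =>
    rw [rowLoad_insert hj.2.1]
    split_ifs with hr
    exacts [hj.2.2 r hr, ih]

theorem price_natCast [Semiring 𝕜] (β : ℕ) :
    ((price S β Y i : ℕ) : 𝕜) = price S (β : 𝕜) Y i := by
  simp [price]

theorem IsMaximalGreedy.of_natCast_eq_mul {β : ℕ} {C : ι → ℕ} {c : ι → ℝ} {q : ℝ} (hq : 0 < q)
    (hC : ∀ i, (C i : ℝ) = q * c i) (hY : IsMaximalGreedy S β b C Y) :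
    IsMaximalGreedy S (β : ℝ) b c Y := by
  have available_iff : ∀ Y i, Available S b c Y i ↔ Available S b C Y i := fun Y i => by
    rw [Available, Available, ← Nat.cast_pos (α := ℝ), hC, mul_pos_iff_of_pos_left hq]
  have isGreedy : ∀ {Y}, IsGreedy S β b C Y → IsGreedy S (β : ℝ) b c Y := by
    intro Y hY
    induction hY with
    | empty => exact .empty
    | @insert Y j _ hj hmin ih =>
      refine ih.insert ((available_iff Y j).2 hj) fun i hi => ?_
      have h := hmin i ((available_iff Y i).1 hi)
      rw [← Nat.cast_le (α := ℝ), Nat.cast_mul, Nat.cast_mul, hC, hC, price_natCast,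
        price_natCast, mul_assoc, mul_assoc] at h
      exact le_of_mul_le_mul_left h hq
  exact ⟨isGreedy hY.isGreedy, fun i hi => hY.not_available i ((available_iff Y i).1 hi)⟩

theorem exists_isMaximalGreedy [Finite ι] (S : R → Finset ι) (β : ℝ) (b : ℕ) (c : ι → ℝ) :
    ∃ Y, IsMaximalGreedy S β b c Y := by
  classical
  cases nonempty_fintype ι
  obtain ⟨Y, hY, hcard⟩ := Finset.exists_max_image (Finset.univ.filter (IsGreedy S β b c))
    Finset.card ⟨∅, by simp [IsGreedy.empty]⟩
  rw [Finset.mem_filter_univ] at hY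
  refine ⟨Y, hY, fun i hi => ?_⟩
  obtain ⟨j, hj, hmin⟩ := Finset.exists_min_image (Finset.univ.filter (Available S b c Y))
    (fun i => price S β Y i / c i) ⟨i, by simpa using hi⟩
  simp only [Finset.mem_filter_univ] at hj hmin hcard
  have hinsert : IsGreedy S β b c (insert j Y) := hY.insert hj fun i hi => by
    have h := hmin i hi
    rw [div_le_div_iff₀ hj.1 hi.1] at h
    linarith
  have := hcard _ hinsert
  rw [Finset.card_insert_of_notMem hj.2.1] at this
  omega

theorem potential_insert [Ring 𝕜] {β : 𝕜} (hj : j ∉ Y) :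
    potential S β (insert j Y) = potential S β Y + (β - 1) * price S β Y j := by
  rw [potential, potential, price, Finset.mul_sum, Finset.sum_filter, ← Finset.sum_add_distrib]
  refine Finset.sum_congr rfl fun r _ => ?_
  rw [rowLoad_insert hj]
  split_ifs
  · rw [pow_succ', sub_mul, one_mul, add_sub_cancel]
  · rw [add_zero, add_zero]

theorem card_saturated_mul_le {β : ℝ} (hβ : 1 ≤ β) :
    ({r | b ≤ rowLoad S Y r} : Finset R).card * β ^ b ≤ potential S β Y := by
  rw [← nsmul_eq_mul]
  refine (Finset.card_nsmul_le_sum _ _ _ fun r hr => ?_).trans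
    (Finset.sum_le_univ_sum_of_nonneg fun r => by positivity)
  exact pow_le_pow_right₀ hβ (by simpa using hr)

theorem potential_insert_le {β O : ℝ} {c : ι → ℝ} (hβ : 1 ≤ β) (hO : 0 < O) (hj : j ∉ Y)
    (hprice : O * price S β Y j ≤ 2 * (c j * (b * potential S β Y))) :
    potential S β (insert j Y) ≤ potential S β Y * Real.exp (2 * b * β * c j / O) := by
  have hΦ : 0 ≤ potential S β Y := Finset.sum_nonneg fun r _ => by positivity
  calc potential S β (insert j Y) = potential S β Y + (β - 1) * price S β Y j :=
        potential_insert hj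
    _ ≤ potential S β Y + β * (2 * (c j * (b * potential S β Y)) / O) := by
        gcongr
        · exact Finset.sum_nonneg fun r _ => by positivity
        · linarith
        · rwa [le_div_iff₀' hO]
    _ = potential S β Y * (2 * b * β * c j / O + 1) := by ring
    _ ≤ _ := mul_le_mul_of_nonneg_left (Real.add_one_le_exp _) hΦ

theorem four_mul_potential_mul_le {β C O W : ℝ} (hW₀ : 0 ≤ W) (hC : 4 * β * C ≤ O) (hO : 0 < O)
    (hbase : 4 * (Fintype.card R * Real.exp (b / 2) * W) ≤ O * β ^ b)
    (hY : potential S β Y ≤ Fintype.card R * Real.exp (2 * b * β * C / O)) :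
    4 * (potential S β Y * W) ≤ O * β ^ b := by
  have hexponent : 2 * b * β * C / O ≤ b / 2 := by
    rw [div_le_div_iff₀ hO two_pos]
    nlinarith [b.cast_nonneg (α := ℝ)]
  refine (mul_le_mul_of_nonneg_left (mul_le_mul_of_nonneg_right (hY.trans ?_) hW₀)
    zero_le_four).trans hbase
  gcongr

section Feasible

variable [Fintype ι] {β W : ℝ} {c x : ι → ℝ}

open Classical in
theorem sum_mul_le_add_sum_available (hc : ∀ i, 0 ≤ c i) (hx₀ : ∀ i, 0 ≤ x i) (hx₁ : ∀ i, x i ≤ 1)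
    (hW : ∀ r, ∑ i ∈ S r, c i * x i ≤ W) :
    ∑ i, c i * x i ≤ ∑ i ∈ Y, c i + ({r | b ≤ rowLoad S Y r} : Finset R).card * W +
      ∑ i with Available S b c Y i, c i * x i := by
  have hcx : ∀ i, 0 ≤ c i * x i := fun i => mul_nonneg (hc i) (hx₀ i)
  have hcover : ∀ i, c i * x i ≤ (if i ∈ Y then c i else 0) +
      (∑ r with b ≤ rowLoad S Y r, if i ∈ S r then c i * x i else 0) +
      if Available S b c Y i then c i * x i else 0 := by
    intro i
    have hchosen : 0 ≤ if i ∈ Y then c i else 0 := ite_nonneg (hc i) le_rfl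
    have hterm : ∀ r, 0 ≤ if i ∈ S r then c i * x i else 0 := fun r => ite_nonneg (hcx i) le_rfl
    have hsaturated := Finset.sum_nonneg (s := {r | b ≤ rowLoad S Y r}) fun r _ => hterm r
    by_cases havail : Available S b c Y i
    · rw [if_pos havail]
      linarith
    rw [if_neg havail, add_zero]
    by_cases hY : i ∈ Y
    · rw [if_pos hY] at hchosen ⊢
      linarith [mul_le_of_le_one_right (hc i) (hx₁ i)]
    rcases (hc i).eq_or_lt with h0 | hpos
    · rw [← h0, zero_mul] at *
      positivity
    obtain ⟨r, hr, hb⟩ : ∃ r, i ∈ S r ∧ b ≤ rowLoad S Y r := by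
      by_contra! h
      exact havail ⟨hpos, hY, h⟩
    have := Finset.single_le_sum (fun r _ => hterm r)
      (show r ∈ ({r | b ≤ rowLoad S Y r} : Finset R) by simpa using hb)
    rw [if_pos hr] at this
    linarith
  calc ∑ i, c i * x i ≤ _ := Finset.sum_le_sum fun i _ => hcover i
    _ = ∑ i ∈ Y, c i + ∑ r with b ≤ rowLoad S Y r, ∑ i ∈ S r, c i * x i +
        ∑ i with Available S b c Y i, c i * x i := by
      rw [Finset.sum_add_distrib, Finset.sum_add_distrib, Finset.sum_comm]
      simp only [Finset.sum_ite_mem, Finset.univ_inter, Finset.sum_filter]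
    _ ≤ _ := by
      rw [← nsmul_eq_mul]
      gcongr
      exact Finset.sum_le_card_nsmul _ _ _ fun r _ => hW r

theorem sum_mul_price_le (hβ : 0 ≤ β) (hrow : ∀ r, ∑ i ∈ S r, x i ≤ b) :
    ∑ i, x i * price S β Y i ≤ b * potential S β Y := by
  simp only [price, potential, Finset.mul_sum, Finset.sum_filter, mul_ite, mul_zero]
  rw [Finset.sum_comm]
  refine Finset.sum_le_sum fun r _ => ?_
  rw [Finset.sum_ite_mem, Finset.univ_inter, ← Finset.sum_mul]
  exact mul_le_mul_of_nonneg_right (hrow r) (pow_nonneg hβ _)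

open Classical in
theorem sum_mul_le_two_mul_sum_available (hβ : 1 ≤ β) (hc : ∀ i, 0 ≤ c i) (hx₀ : ∀ i, 0 ≤ x i)
    (hx₁ : ∀ i, x i ≤ 1) (hW₀ : 0 ≤ W) (hW : ∀ r, ∑ i ∈ S r, c i * x i ≤ W)
    (hchosen : 4 * ∑ i ∈ Y, c i ≤ ∑ i, c i * x i)
    (hpotential : 4 * (potential S β Y * W) ≤ (∑ i, c i * x i) * β ^ b) :
    ∑ i, c i * x i ≤ 2 * ∑ i with Available S b c Y i, c i * x i := by
  have hcover := sum_mul_le_add_sum_available (Y := Y) (b := b) hc hx₀ hx₁ hW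
  have hsaturated : 4 * (({r | b ≤ rowLoad S Y r} : Finset R).card * W) ≤ ∑ i, c i * x i := by
    refine le_of_mul_le_mul_right ?_ (show 0 < β ^ b by positivity)
    linarith [mul_le_mul_of_nonneg_right (card_saturated_mul_le (S := S) (Y := Y) (b := b) hβ) hW₀]
  linarith

open Classical in
theorem sum_available_mul_price_le (hβ : 0 ≤ β) (hx₀ : ∀ i, 0 ≤ x i)
    (hrow : ∀ r, ∑ i ∈ S r, x i ≤ b) (hcj : 0 ≤ c j)
    (hmin : ∀ i, Available S b c Y i → c i * price S β Y j ≤ c j * price S β Y i) :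
    (∑ i with Available S b c Y i, c i * x i) * price S β Y j ≤ c j * (b * potential S β Y) :=
  calc (∑ i with Available S b c Y i, c i * x i) * price S β Y j
      = ∑ i with Available S b c Y i, x i * (c i * price S β Y j) := by
        rw [Finset.sum_mul]
        exact Finset.sum_congr rfl fun i _ => by ring
    _ ≤ ∑ i with Available S b c Y i, x i * (c j * price S β Y i) :=
        Finset.sum_le_sum fun i hi =>
          mul_le_mul_of_nonneg_left (hmin i ((Finset.mem_filter_univ i).1 hi)) (hx₀ i)
    _ ≤ ∑ i, x i * (c j * price S β Y i) :=
        Finset.sum_le_univ_sum_of_nonneg fun i =>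
          mul_nonneg (hx₀ i) (mul_nonneg hcj (Finset.sum_nonneg fun r _ => pow_nonneg hβ _))
    _ = c j * ∑ i, x i * price S β Y i := by
        rw [Finset.mul_sum]
        exact Finset.sum_congr rfl fun i _ => by ring
    _ ≤ c j * (b * potential S β Y) :=
        mul_le_mul_of_nonneg_left (sum_mul_price_le hβ hrow) hcj

theorem IsGreedy.potential_le_exp (hβ : 1 ≤ β) (hc : ∀ i, 0 ≤ c i) (hx₀ : ∀ i, 0 ≤ x i)
    (hx₁ : ∀ i, x i ≤ 1) (hrow : ∀ r, ∑ i ∈ S r, x i ≤ b) (hW₀ : 0 ≤ W)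
    (hW : ∀ r, ∑ i ∈ S r, c i * x i ≤ W) (hO : 0 < ∑ i, c i * x i)
    (hbase : 4 * (Fintype.card R * Real.exp (b / 2) * W) ≤ (∑ i, c i * x i) * β ^ b)
    (hY : IsGreedy S β b c Y) (hlt : 4 * β * ∑ i ∈ Y, c i < ∑ i, c i * x i) :
    potential S β Y ≤
      Fintype.card R * Real.exp (2 * b * β * (∑ i ∈ Y, c i) / ∑ i, c i * x i) := by
  classical
  induction hY with
  | empty => simp [potential, rowLoad]
  | @insert Y j _ hj hmin ih =>
    rw [Finset.sum_insert hj.2.1] at hlt ⊢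
    have hlt' : 4 * β * ∑ i ∈ Y, c i < ∑ i, c i * x i := by nlinarith [hc j]
    have hpotential := four_mul_potential_mul_le hW₀ hlt'.le hO hbase (ih hlt')
    have hchosen : 4 * ∑ i ∈ Y, c i ≤ ∑ i, c i * x i := by
      nlinarith [Finset.sum_nonneg fun i (_ : i ∈ Y) => hc i]
    have havail := sum_mul_le_two_mul_sum_available hβ hc hx₀ hx₁ hW₀ hW hchosen hpotential
    have hprice₀ : 0 ≤ price S β Y j := Finset.sum_nonneg fun r _ => by positivity
    have havail_price := sum_available_mul_price_le (zero_le_one.trans hβ) hx₀ hrow (hc j) hmin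
    have hprice : (∑ i, c i * x i) * price S β Y j ≤ 2 * (c j * (b * potential S β Y)) := by
      linarith [mul_le_mul_of_nonneg_right havail hprice₀]
    calc _ ≤ _ := potential_insert_le hβ hO hj.2.1 hprice
      _ ≤ _ := mul_le_mul_of_nonneg_right (ih hlt') (Real.exp_nonneg _)
      _ = _ := by
        rw [mul_assoc, ← Real.exp_add]
        congr 2
        ring

theorem IsMaximalGreedy.sum_mul_le (hβ : 1 ≤ β) (hc : ∀ i, 0 ≤ c i) (hx₀ : ∀ i, 0 ≤ x i)
    (hx₁ : ∀ i, x i ≤ 1) (hrow : ∀ r, ∑ i ∈ S r, x i ≤ b) (hW₀ : 0 ≤ W)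
    (hW : ∀ r, ∑ i ∈ S r, c i * x i ≤ W)
    (hbase : 4 * (Fintype.card R * Real.exp (b / 2) * W) ≤ (∑ i, c i * x i) * β ^ b)
    (hY : IsMaximalGreedy S β b c Y) :
    ∑ i, c i * x i ≤ 4 * β * ∑ i ∈ Y, c i := by
  classical
  by_contra! hlt
  have hcY : 0 ≤ ∑ i ∈ Y, c i := Finset.sum_nonneg fun i _ => hc i
  have hO : 0 < ∑ i, c i * x i := lt_of_le_of_lt (by positivity) hlt
  have hpotential := four_mul_potential_mul_le hW₀ hlt.le hO hbase <|
    hY.isGreedy.potential_le_exp hβ hc hx₀ hx₁ hrow hW₀ hW hO hbase hlt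
  have havail := sum_mul_le_two_mul_sum_available hβ hc hx₀ hx₁ hW₀ hW (by nlinarith) hpotential
  simp only [hY.not_available, Finset.filter_false, Finset.sum_empty, mul_zero] at havail
  linarith

end Feasible

end Greedy

/-! ### Rounding optimal solutions -/

/-- `y` is a 0-1 vector with `‖A y‖_∞ ≤ b` whose objective value is at least `c ⬝ᵥ x / ρ`. -/
def IsRoundingWithin {m n : ℕ} (ρ : ℝ) (A : Matrix (Fin m) (Fin n) ℝ) (b : ℕ)
    (c x y : Fin n → ℝ) : Prop :=
  (∀ i, y i = 0 ∨ y i = 1) ∧ ‖A *ᵥ y‖ ≤ (b : ℝ) ∧ c ⬝ᵥ x ≤ ρ * (c ⬝ᵥ y)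

section LinearProgram

variable {m n k b : ℕ} {S : Fin m → Finset (Fin n)} {p d ρ : ℝ} {c x : Fin n → ℝ}

theorem zeroOneMatrix_mulVec_apply (S : Fin m → Finset (Fin n)) (z : Fin n → ℝ) (r : Fin m) :
    (zeroOneMatrix S *ᵥ z) r = ∑ i ∈ S r, z i := by
  simp [Matrix.mulVec, dotProduct, zeroOneMatrix]

theorem isRoundingWithin_indicator {Y : Finset (Fin n)} (hload : ∀ r, rowLoad S Y r ≤ b)
    (hsum : c ⬝ᵥ x ≤ ρ * ∑ i ∈ Y, c i) :
    IsRoundingWithin ρ (zeroOneMatrix S) b c x fun i => if i ∈ Y then 1 else 0 := by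
  refine ⟨fun i => (ite_eq_or_eq _ _ _).symm, ?_, by simpa [dotProduct] using hsum⟩
  refine (pi_norm_le_iff_of_nonneg b.cast_nonneg).2 fun r => ?_
  rw [zeroOneMatrix_mulVec_apply, Finset.sum_ite_mem, Finset.sum_const, nsmul_one]
  simpa [rowLoad] using hload r

theorem IsLPOptimal.mul_min_le (hS : ∀ r, (S r).card ≤ k) (hp : 0 < p) (hc : ∀ i, 1 / p ≤ c i)
    (h : IsLPOptimal (zeroOneMatrix S) b c x) : n * min 1 (b / k : ℝ) ≤ p * (c ⬝ᵥ x) := by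
  set μ : ℝ := min 1 (b / k)
  have hμ : 0 ≤ μ := by positivity
  have hconst : (fun _ => μ) ∈ packingPolytope (zeroOneMatrix S) b := by
    refine ⟨fun i => ⟨hμ, min_le_left _ _⟩, fun r => ?_⟩
    calc (zeroOneMatrix S *ᵥ fun _ => μ) r = (S r).card * μ := by
          simp [zeroOneMatrix_mulVec_apply]
      _ ≤ k * (b / k) := by
          gcongr
          exacts [hS r, min_le_right _ _]
      _ ≤ b := by
          rw [mul_div_left_comm]
          exact mul_le_of_le_one_right b.cast_nonneg (div_self_le_one _)
  calc n * μ = p * ∑ _i : Fin n, 1 / p * μ := by simp; field_simp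
    _ ≤ p * (c ⬝ᵥ fun _ => μ) := by
      gcongr
      exact Finset.sum_le_sum fun i _ => mul_le_mul_of_nonneg_right (hc i) hμ
    _ ≤ p * (c ⬝ᵥ x) := mul_le_mul_of_nonneg_left (h.2 hconst) hp.le

theorem sum_row_le (hS : ∀ r, (S r).card ≤ k) (hc : ∀ i, c i ≤ 1)
    (hx : x ∈ packingPolytope (zeroOneMatrix S) b) (r : Fin m) :
    ∑ i ∈ S r, c i * x i ≤ k * min 1 (b / k : ℝ) := by
  have hcx : ∑ i ∈ S r, c i * x i ≤ ∑ i ∈ S r, x i :=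
    Finset.sum_le_sum fun i _ => mul_le_of_le_one_left (hx.1 i).1 (hc i)
  rcases k.eq_zero_or_pos with rfl | hk
  · simp [Finset.card_eq_zero.1 (Nat.le_zero.1 (hS r))]
  rw [mul_min_of_nonneg _ _ k.cast_nonneg, mul_one, mul_div_cancel₀ _ (by positivity)]
  refine hcx.trans (le_min ?_ ?_)
  · calc ∑ i ∈ S r, x i ≤ (S r).card • (1 : ℝ) :=
          Finset.sum_le_card_nsmul _ _ _ fun i _ => (hx.1 i).2
      _ ≤ k := by simpa using hS r
  · simpa [zeroOneMatrix_mulVec_apply] using hx.2 r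

theorem IsLPOptimal.exists_row_bound (hS : ∀ r, (S r).card ≤ k) (hp : 0 < p) (hd : 0 ≤ d)
    (hmk : (m * k : ℝ) ≤ d * n) (hc : ∀ i, 1 / p ≤ c i ∧ c i ≤ 1)
    (h : IsLPOptimal (zeroOneMatrix S) b c x) :
    ∃ W : ℝ, 0 ≤ W ∧ (∀ r, ∑ i ∈ S r, c i * x i ≤ W) ∧ m * W ≤ min (m : ℝ) (p * d) * (c ⬝ᵥ x) := by
  have hcx : ∀ i, 0 ≤ c i * x i := fun i =>
    mul_nonneg ((one_div_pos.2 hp).le.trans (hc i).1) (h.1.1 i).1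
  have hO : 0 ≤ c ⬝ᵥ x := Finset.sum_nonneg fun i _ => hcx i
  refine ⟨min (c ⬝ᵥ x) (k * min 1 (b / k : ℝ)), by positivity, fun r => le_min
    (Finset.sum_le_univ_sum_of_nonneg hcx) (sum_row_le hS (fun i => (hc i).2) h.1 r), ?_⟩
  rw [min_mul_of_nonneg _ _ hO]
  refine le_min (by gcongr; exact min_le_left _ _) ?_
  calc m * min (c ⬝ᵥ x) (k * min 1 (b / k : ℝ)) ≤ m * (k * min 1 (b / k : ℝ)) := by
        gcongr
        exact min_le_right _ _
    _ = m * k * min 1 (b / k : ℝ) := by ring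
    _ ≤ d * n * min 1 (b / k : ℝ) := by gcongr
    _ = d * (n * min 1 (b / k : ℝ)) := by ring
    _ ≤ d * (p * (c ⬝ᵥ x)) :=
        mul_le_mul_of_nonneg_left (h.mul_min_le hS hp fun i => (hc i).1) hd
    _ = p * d * (c ⬝ᵥ x) := by ring

theorem exp_half_le_two_pow (b : ℕ) : Real.exp (b / 2) ≤ 2 ^ b := by
  have hlog : (1 / 2 : ℝ) ≤ Real.log 2 := by linarith [Real.log_two_gt_d9]
  calc Real.exp (b / 2) = Real.exp (b * (1 / 2)) := by ring_nf
    _ ≤ Real.exp (b * Real.log 2) := by gcongr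
    _ = 2 ^ b := by rw [Real.exp_nat_mul, Real.exp_log two_pos]

theorem exists_base {lam : ℝ} (hb : b ≠ 0) (hlam : 1 ≤ lam) (hm : lam ≤ m) :
    ∃ β : ℕ, 1 ≤ β ∧ β ≤ 8 * m ∧ (β : ℝ) ≤ 9 * lam ^ (1 / b : ℝ) ∧
      4 * (Real.exp (b / 2) * lam) ≤ (β : ℝ) ^ b := by
  have hexponent : 0 ≤ (1 / b : ℝ) := by positivity
  have hroot_le : (4 * lam) ^ (1 / b : ℝ) ≤ 4 * lam :=
    Real.rpow_le_self_of_one_le (by linarith) (by simpa using Nat.cast_inv_le_one b)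
  have hroot_le' : (4 * lam) ^ (1 / b : ℝ) ≤ 4 * lam ^ (1 / b : ℝ) := by
    rw [Real.mul_rpow zero_le_four (by linarith)]
    gcongr
    exact Real.rpow_le_self_of_one_le (by linarith) (by simpa using Nat.cast_inv_le_one b)
  have hone : 1 ≤ lam ^ (1 / b : ℝ) := Real.one_le_rpow hlam hexponent
  have hone' : 1 ≤ (4 * lam) ^ (1 / b : ℝ) := Real.one_le_rpow (by linarith) hexponent
  refine ⟨⌈2 * (4 * lam) ^ (1 / b : ℝ)⌉₊, Nat.one_le_ceil_iff.2 (by linarith), ?_, ?_, ?_⟩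
  · refine Nat.ceil_le.2 ?_
    push_cast
    linarith
  · refine (Nat.ceil_lt_add_one (by linarith)).le.trans ?_
    linarith
  · calc 4 * (Real.exp (b / 2) * lam) = Real.exp (b / 2) * (4 * lam) := by ring
      _ ≤ 2 ^ b * (4 * lam) := by
        gcongr
        exact exp_half_le_two_pow b
      _ = (2 * (4 * lam) ^ (1 / b : ℝ)) ^ b := by
        rw [mul_pow, one_div, Real.rpow_inv_natCast_pow (by linarith) hb]
      _ ≤ _ := by
        gcongr
        exact Nat.le_ceil _

theorem IsLPOptimal.exists_base_forall_isMaximalGreedy (hm : 1 ≤ m) (hb : b ≠ 0)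
    (hS : ∀ r, (S r).card ≤ k) (hp : 1 ≤ p) (hd : 1 ≤ d) (hmk : (m * k : ℝ) ≤ d * n)
    (hc : ∀ i, 1 / p ≤ c i ∧ c i ≤ 1) (h : IsLPOptimal (zeroOneMatrix S) b c x) :
    ∃ β : ℕ, 1 ≤ β ∧ β ≤ 8 * m ∧ ∀ Y, IsMaximalGreedy S (β : ℝ) b c Y →
      c ⬝ᵥ x ≤ 36 * min (m : ℝ) (p * d) ^ (1 / b : ℝ) * ∑ i ∈ Y, c i := by
  have hc₀ : ∀ i, 0 ≤ c i := fun i => (one_div_nonneg.2 (zero_le_one.trans hp)).trans (hc i).1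
  obtain ⟨W, hW₀, hW, hmW⟩ := h.exists_row_bound hS (zero_lt_one.trans_le hp)
    (zero_le_one.trans hd) hmk hc
  obtain ⟨β, hβ, hβm, hβ_le, hpow⟩ := exists_base (m := m) hb
    (le_min (by exact_mod_cast hm) (one_le_mul_of_one_le_of_one_le hp hd)) (min_le_left _ _)
  have hO : 0 ≤ c ⬝ᵥ x := Finset.sum_nonneg fun i _ => mul_nonneg (hc₀ i) (h.1.1 i).1
  refine ⟨β, hβ, hβm, fun Y hY => ?_⟩
  have hbase : 4 * (m * Real.exp (b / 2) * W) ≤ (c ⬝ᵥ x) * (β : ℝ) ^ b := by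
    linarith [mul_le_mul_of_nonneg_left hmW (Real.exp_nonneg (b / 2)),
      mul_le_mul_of_nonneg_left hpow hO]
  calc c ⬝ᵥ x ≤ 4 * β * ∑ i ∈ Y, c i :=
        hY.sum_mul_le (by exact_mod_cast hβ) hc₀ (fun i => (h.1.1 i).1) (fun i => (h.1.1 i).2)
          (fun r => by simpa [zeroOneMatrix_mulVec_apply] using h.1.2 r) hW₀ hW
          (by simpa [dotProduct] using hbase)
    _ ≤ 4 * (9 * min (m : ℝ) (p * d) ^ (1 / b : ℝ)) * ∑ i ∈ Y, c i := by
        gcongr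
        exact Finset.sum_nonneg fun i _ => hc₀ i
    _ = _ := by ring

end LinearProgram

/-! ### Running times of machine programs -/

/-- The contents of the arrays of a machine. -/
abbrev Memory : Type := ℕ → ℕ → ℕ

theorem size_mul_le (x y : ℕ) : (x * y).size ≤ x.size + y.size := by
  rw [Nat.size_le, pow_add]
  exact Nat.mul_lt_mul'' (Nat.lt_size_self x) (Nat.lt_size_self y)

theorem size_add_le (x y : ℕ) : (x + y).size ≤ x.size + y.size := by
  rcases x.eq_zero_or_pos with rfl | hx
  · simp
  rcases y.eq_zero_or_pos with rfl | hy
  · simp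
  rw [Nat.size_le, pow_add]
  have := Nat.lt_size_self x
  have := Nat.lt_size_self y
  nlinarith

/-- If all cells have bit length at most `B`, then the value of the expression has bit length at
most `e.sizeWeight * (B + 1)`. -/
def Expr.sizeWeight : Expr → ℕ
  | .lit v => v.size
  | .get _ _ => 1
  | .add e f => e.sizeWeight + f.sizeWeight
  | .sub e _ => e.sizeWeight
  | .mul e f => e.sizeWeight + f.sizeWeight
  | .div e _ => e.sizeWeight

/-- If all cells have bit length at most `B`, then the expression is evaluated at cost at most
`e.costWeight * (B + 1)`. -/
def Expr.costWeight : Expr → ℕ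
  | .lit v => 1 + v.size
  | .get _ i => i.costWeight + 1
  | .add e f => e.costWeight + f.costWeight + (1 + (e.sizeWeight + f.sizeWeight))
  | .sub e f => e.costWeight + f.costWeight + (1 + e.sizeWeight)
  | .mul e f => e.costWeight + f.costWeight + (1 + (e.sizeWeight + f.sizeWeight))
  | .div e f => e.costWeight + f.costWeight + (1 + e.sizeWeight)

section CostOfExpressions

variable {B : ℕ} {σ : Memory}

theorem Expr.size_eval_le (hσ : ∀ a i, (σ a i).size ≤ B) (e : Expr) :
    (e.eval σ).size ≤ e.sizeWeight * (B + 1) := by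
  induction e with
  | lit v => exact Nat.le_mul_of_pos_right _ B.succ_pos
  | get a i _ => simpa [eval, sizeWeight] using (hσ a (i.eval σ)).trans B.le_succ
  | add e f he hf =>
    rw [sizeWeight, add_mul]
    exact (size_add_le _ _).trans (Nat.add_le_add he hf)
  | sub e f he _ => exact (Nat.size_le_size (Nat.sub_le _ _)).trans he
  | mul e f he hf =>
    rw [sizeWeight, add_mul]
    exact (size_mul_le _ _).trans (Nat.add_le_add he hf)
  | div e f he _ => exact (Nat.size_le_size (Nat.div_le_self _ _)).trans he

theorem Expr.cost_le (hσ : ∀ a i, (σ a i).size ≤ B) (e : Expr) :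
    e.cost σ ≤ e.costWeight * (B + 1) := by
  induction e with
  | lit v => exact Nat.le_mul_of_pos_right _ B.succ_pos
  | get a i hi =>
    rw [cost, costWeight, add_mul]
    have := hσ a (i.eval σ)
    omega
  | add e f he hf =>
    have := size_eval_le hσ (.add e f)
    rw [eval, sizeWeight] at this
    rw [cost, costWeight, add_mul, add_mul, add_mul]
    omega
  | sub e f he hf =>
    have := size_eval_le hσ (.sub e f)
    rw [eval, sizeWeight] at this
    rw [cost, costWeight, add_mul, add_mul, add_mul]
    omega
  | mul e f he hf =>
    have := size_eval_le hσ (.mul e f)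
    rw [eval, sizeWeight] at this
    rw [cost, costWeight, add_mul, add_mul, add_mul]
    omega
  | div e f he hf =>
    have := size_eval_le hσ (.div e f)
    rw [eval, sizeWeight] at this
    rw [cost, costWeight, add_mul, add_mul, add_mul]
    omega

end CostOfExpressions

/-- A bound for the cost of a run in which all cells have bit length at most `B` and every loop is
iterated at most `ℓ` times. It is defined over a semiring, so that `B` and `ℓ` can be polynomials in
the length of the input. -/
def Prog.costBound {R : Type*} [CommSemiring R] (B ℓ : R) : Prog → R
  | .skip => 1
  | .set _ i e => (i.costWeight + e.costWeight : ℕ) * (B + 1) + 1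
  | .flip _ i => i.costWeight * (B + 1) + 1
  | .seq P Q => P.costBound B ℓ + Q.costBound B ℓ
  | .cond e P Q => e.costWeight * (B + 1) + 1 + (P.costBound B ℓ + Q.costBound B ℓ)
  | .loop e P => (ℓ + 1) * (e.costWeight * (B + 1) + 1 + P.costBound B ℓ)

theorem Prog.eval_costBound (B ℓ : Polynomial ℕ) (L : ℕ) (P : Prog) :
    (P.costBound B ℓ).eval L = P.costBound (B.eval L) (ℓ.eval L) := by
  induction P <;> simp_all [Prog.costBound]

/-- The arrays that the program may modify. -/
def Prog.writes : Prog → List ℕ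
  | .skip => []
  | .set a _ _ => [a]
  | .flip a _ => [a]
  | .seq P Q => P.writes ++ Q.writes
  | .cond _ P Q => P.writes ++ Q.writes
  | .loop _ P => P.writes

/-- The memories agree on all arrays outside the list. -/
def AgreeOff (l : List ℕ) (σ τ : Memory) : Prop := ∀ a ∉ l, τ a = σ a

theorem write_apply_of_ne {a a' : ℕ} (h : a' ≠ a) (σ : Memory) (i v : ℕ) :
    write σ a i v a' = σ a' :=
  Function.update_of_ne h _ _

theorem write_apply_self (σ : Memory) (a i v : ℕ) :
    write σ a i v a = Function.update (σ a) i v :=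
  Function.update_self _ _ _

theorem Exec.agreeOff {ω : ℕ → Bool} {P : Prog} {s s' : State} {t : ℕ} (h : Exec ω P s s' t) :
    AgreeOff P.writes s.arr s'.arr := by
  induction h with
  | skip | loopFalse => exact fun _ _ => rfl
  | set | flip => exact fun a ha => write_apply_of_ne (by simpa [Prog.writes] using ha) _ _ _
  | seq _ _ ihP ihQ =>
    intro a ha
    rw [Prog.writes, List.mem_append, not_or] at ha
    exact (ihQ a ha.2).trans (ihP a ha.1)
  | condTrue _ _ ih => exact fun a ha => ih a fun h => ha (List.mem_append_left _ h)
  | condFalse _ _ ih => exact fun a ha => ih a fun h => ha (List.mem_append_right _ h)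
  | loopTrue _ _ _ ih ih' => exact fun a ha => (ih' a ha).trans (ih a ha)

/-- All cells contain numbers up to `M`. -/
def Bounded (M : ℕ) (σ : Memory) : Prop := ∀ a i, σ a i ≤ M

theorem Bounded.write {M : ℕ} {σ : Memory} (hσ : Bounded M σ) {a i v : ℕ} (hv : v ≤ M) :
    Bounded M (write σ a i v) := by
  intro a' i'
  simp only [PackingRounding.write, Function.update_apply]
  split_ifs
  · rw [Function.update_apply]
    split_ifs
    exacts [hv, hσ a i']
  · exact hσ a' i'

theorem Bounded.cost_le {M : ℕ} {σ : Memory} (hσ : Bounded M σ) (e : Expr) :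
    e.cost σ ≤ e.costWeight * (M.size + 1) :=
  e.cost_le fun a i => Nat.size_le_size (hσ a i)

/-- A weakest precondition for total correctness within given resources: if the numbers in the
cells are at most `M`, then, whatever the random bits, the program halts in a memory that satisfies
`post`, without storing a number larger than `M`, and at a cost in accordance with at most `ℓ`
iterations per loop. -/
def Prog.wp (M ℓ : ℕ) (P : Prog) (post : Memory → Prop) (σ : Memory) : Prop :=
  Bounded M σ → ∃ τ, Bounded M τ ∧ post τ ∧
    ∀ ω u, ∃ t ≤ P.costBound M.size ℓ, Exec ω P ⟨σ, u⟩ ⟨τ, u⟩ t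

namespace Prog

variable {M ℓ : ℕ} {σ : Memory} {post : Memory → Prop} {P Q : Prog} {e : Expr}

theorem wp.mono {post' : Memory → Prop} (h : P.wp M ℓ post σ) (hpost : ∀ τ, post τ → post' τ) :
    P.wp M ℓ post' σ := fun hσ =>
  let ⟨τ, hτ, h, hP⟩ := h hσ
  ⟨τ, hτ, hpost τ h, hP⟩

theorem wp.frame (h : P.wp M ℓ post σ) :
    P.wp M ℓ (fun τ => AgreeOff P.writes σ τ ∧ post τ) σ := fun hσ =>
  let ⟨τ, hτ, h, hP⟩ := h hσ
  let ⟨_, _, hexec⟩ := hP (fun _ => false) 0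
  ⟨τ, hτ, ⟨hexec.agreeOff, h⟩, hP⟩

theorem wp_skip (h : post σ) : skip.wp M ℓ post σ := fun hσ =>
  ⟨σ, hσ, h, fun _ _ => ⟨1, le_rfl, .skip _⟩⟩

theorem wp_set {a : ℕ} {i : Expr} (hv : e.eval σ ≤ M)
    (h : post (write σ a (i.eval σ) (e.eval σ))) : (set a i e).wp M ℓ post σ := fun hσ => by
  refine ⟨_, hσ.write hv, h, fun ω u => ⟨_, ?_, .set _ _ _ _⟩⟩
  have := hσ.cost_le i
  have := hσ.cost_le e
  rw [costBound, Nat.cast_id, add_mul]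
  simp only
  omega

theorem wp_seq (h : P.wp M ℓ (Q.wp M ℓ post) σ) : (seq P Q).wp M ℓ post σ := fun hσ => by
  obtain ⟨τ, hτ, h, hP⟩ := h hσ
  obtain ⟨υ, hυ, h, hQ⟩ := h hτ
  refine ⟨υ, hυ, h, fun ω u => ?_⟩
  obtain ⟨t, ht, hP⟩ := hP ω u
  obtain ⟨t', ht', hQ⟩ := hQ ω u
  exact ⟨t + t', Nat.add_le_add ht ht', .seq hP hQ⟩

theorem wp_cond (hP : e.eval σ ≠ 0 → P.wp M ℓ post σ) (hQ : e.eval σ = 0 → Q.wp M ℓ post σ) :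
    (cond e P Q).wp M ℓ post σ := fun hσ => by
  have he := hσ.cost_le e
  by_cases h : e.eval σ = 0
  · obtain ⟨τ, hτ, hpost, hQ⟩ := hQ h hσ
    refine ⟨τ, hτ, hpost, fun ω u => ?_⟩
    obtain ⟨t, ht, hQ⟩ := hQ ω u
    exact ⟨_, by simp only [costBound, Nat.cast_id]; omega, .condFalse h hQ⟩
  · obtain ⟨τ, hτ, hpost, hP⟩ := hP h hσ
    refine ⟨τ, hτ, hpost, fun ω u => ?_⟩
    obtain ⟨t, ht, hP⟩ := hP ω u
    exact ⟨_, by simp only [costBound, Nat.cast_id]; omega, .condTrue h hP⟩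

theorem exists_exec_loop (k : ℕ) (Inv : ℕ → Memory → Prop) (hσ : Bounded M σ) (h0 : Inv 0 σ)
    (hstep : ∀ j < k, ∀ τ, Inv j τ → e.eval τ ≠ 0 ∧ P.wp M ℓ (Inv (j + 1)) τ)
    (hend : ∀ τ, Inv k τ → e.eval τ = 0) :
    ∃ τ, Bounded M τ ∧ Inv k τ ∧ ∀ ω u, ∃ t ≤
      (k + 1) * (e.costWeight * (M.size + 1) + 1 + P.costBound M.size ℓ),
      Exec ω (loop e P) ⟨σ, u⟩ ⟨τ, u⟩ t := by
  have hcost := hσ.cost_le e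
  induction k generalizing Inv σ with
  | zero =>
    exact ⟨σ, hσ, h0, fun ω u => ⟨_, by simp only; omega, .loopFalse (hend σ h0)⟩⟩
  | succ k ih =>
    obtain ⟨he, hP⟩ := hstep 0 k.succ_pos σ h0
    obtain ⟨τ, hτ, h1, hP⟩ := hP hσ
    obtain ⟨υ, hυ, hInv, hloop⟩ := ih (fun j => Inv (j + 1)) hτ h1
      (fun j hj => hstep (j + 1) (Nat.succ_lt_succ hj)) hend (hτ.cost_le e)
    refine ⟨υ, hυ, hInv, fun ω u => ?_⟩
    obtain ⟨t, ht, hP⟩ := hP ω u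
    obtain ⟨t', ht', hloop⟩ := hloop ω u
    refine ⟨_, ?_, .loopTrue he hP hloop⟩
    rw [add_mul (k + 1)]
    simp only
    omega

theorem wp_loop (k : ℕ) (Inv : ℕ → Memory → Prop) (hk : k ≤ ℓ) (h0 : Inv 0 σ)
    (hstep : ∀ j < k, ∀ τ, Inv j τ → e.eval τ ≠ 0 ∧ P.wp M ℓ (Inv (j + 1)) τ)
    (hend : ∀ τ, Inv k τ → e.eval τ = 0) : (loop e P).wp M ℓ (Inv k) σ := fun hσ => by
  obtain ⟨τ, hτ, hInv, hrun⟩ := exists_exec_loop k Inv hσ h0 hstep hend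
  refine ⟨τ, hτ, hInv, fun ω u => ?_⟩
  obtain ⟨t, ht, hrun⟩ := hrun ω u
  exact ⟨t, ht.trans (by rw [costBound, Nat.cast_id]; gcongr), hrun⟩

end Prog

/-- The scalar variable stored in cell `0` of array `a`. -/
abbrev Expr.var (a : ℕ) : Expr := .get a (.lit 0)

/-- Assignment to a scalar variable. -/
abbrev Prog.assign (a : ℕ) (e : Expr) : Prog := .set a (.lit 0) e

/-- `for i in 0, ..., e - 1 do P`, with the loop variable in array `i`. -/
def Prog.forLoop (i : ℕ) (e : Expr) (P : Prog) : Prog :=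
  .seq (.assign i (.lit 0))
    (.loop (.sub e (.var i)) (.seq P (.assign i (.add (.var i) (.lit 1)))))

theorem Prog.wp_forLoop {M ℓ i k : ℕ} {σ : Memory} {post : Memory → Prop} {P : Prog} {e : Expr}
    (Inv : ℕ → Memory → Prop) (hi : i ∉ P.writes) (hkℓ : k ≤ ℓ) (hkM : k ≤ M)
    (hbound : ∀ τ, AgreeOff (forLoop i e P).writes σ τ → e.eval τ = k)
    (hInv : ∀ j τ v, Inv j τ → Inv j (write τ i 0 v)) (h0 : Inv 0 σ)
    (hstep : ∀ j < k, ∀ τ, AgreeOff (forLoop i e P).writes σ τ → τ i 0 = j → Inv j τ →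
      P.wp M ℓ (Inv (j + 1)) τ)
    (hpost : ∀ τ, AgreeOff (forLoop i e P).writes σ τ → Inv k τ → post τ) :
    (forLoop i e P).wp M ℓ post σ := by
  have hwrites : ∀ a, a ∉ (forLoop i e P).writes ↔ a ≠ i ∧ a ∉ P.writes := fun a => by
    simp only [forLoop, writes, List.mem_append, List.mem_cons, List.not_mem_nil]
    tauto
  refine wp_seq (wp_set (Nat.zero_le M) ((wp_loop k (fun j τ =>
    AgreeOff (forLoop i e P).writes σ τ ∧ τ i 0 = j ∧ Inv j τ) hkℓ ?_ ?_ ?_).mono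
      fun τ hτ => hpost τ hτ.1 hτ.2.2))
  · refine ⟨fun a ha => write_apply_of_ne ((hwrites a).1 ha).1 _ _ _, ?_, hInv _ _ _ h0⟩
    exact congrFun (write_apply_self _ _ _ _) 0
  · rintro j hj τ ⟨hτ, rfl, hτInv⟩
    refine ⟨?_, wp_seq ((hstep _ hj τ hτ rfl hτInv).frame.mono ?_)⟩
    · simp only [Expr.eval, hbound τ hτ]
      omega
    · rintro υ ⟨hυ, hυInv⟩
      have hcounter : (Expr.add (.var i) (.lit 1)).eval υ = τ i 0 + 1 := by
        simp only [Expr.eval, hυ i hi]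
      refine wp_set (hcounter.trans_le (by omega)) ⟨fun a ha => ?_, ?_, hInv _ _ _ hυInv⟩
      · rw [write_apply_of_ne ((hwrites a).1 ha).1, hυ a ((hwrites a).1 ha).2, hτ a ha]
      · rw [write_apply_self, hcounter]
        exact Function.update_self _ _ _
  · rintro τ ⟨hτ, hcounter, -⟩
    simp only [Expr.eval, hbound τ hτ, hcounter, Nat.sub_self]

theorem AgreeOff.trans {l : List ℕ} {σ τ υ : Memory} (h : AgreeOff l σ τ) (h' : AgreeOff l τ υ) :
    AgreeOff l σ υ := fun a ha => (h' a ha).trans (h a ha)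

theorem AgreeOff.mono {l l' : List ℕ} {σ τ : Memory} (h : AgreeOff l σ τ) (hl : l ⊆ l') :
    AgreeOff l' σ τ := fun a ha => h a fun ha' => ha (hl ha')

theorem agreeOff_write {l : List ℕ} {a : ℕ} (ha : a ∈ l) (σ : Memory) (i v : ℕ) :
    AgreeOff l σ (write σ a i v) :=
  fun _ ha' => write_apply_of_ne (ne_of_mem_of_not_mem ha ha').symm σ i v

theorem ofFin_apply {n : ℕ} {v : Fin n → ℕ} (i : Fin n) : ofFin v i = v i := by simp [ofFin]

namespace Prog

theorem wp_assign {M ℓ a : ℕ} {σ : Memory} {post : Memory → Prop} {e : Expr} (he : e.eval σ ≤ M)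
    (hpost : ∀ τ, AgreeOff [a] σ τ → τ a 0 = e.eval σ → post τ) :
    (assign a e).wp M ℓ post σ :=
  wp_set he (hpost _ (agreeOff_write (by simp) _ _ _) (by simp [write_apply_self, Expr.eval]))

/-- `for i in 0, ..., e - 1 do a[i] := f`. -/
def mapLoop (a i : ℕ) (e f : Expr) : Prog := forLoop i e (.set a (.var i) f)

/-- `v := init; for i in 0, ..., e - 1 do v := f`. -/
def foldLoop (v i init : ℕ) (e f : Expr) : Prog :=
  .seq (.assign v (.lit init)) (forLoop i e (.assign v f))

/-- `v := 0; for i in 0, ..., e - 1 do v := v + f`. -/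
def sumLoop (v i : ℕ) (e f : Expr) : Prog := foldLoop v i 0 e (.add (.var v) f)

variable {M ℓ a i k v : ℕ} {σ : Memory} {post : Memory → Prop} {e f : Expr}

theorem wp_mapLoop (F : Fin k → ℕ) (hai : a ≠ i) (hkℓ : k ≤ ℓ) (hkM : k ≤ M)
    (he : ∀ τ, AgreeOff [a, i] σ τ → e.eval τ = k)
    (hf : ∀ j : Fin k, ∀ τ, AgreeOff [a, i] σ τ → τ i 0 = j → τ a j = σ a j → f.eval τ = F j)
    (hF : ∀ j, F j ≤ M) (hpost : ∀ τ, AgreeOff [a, i] σ τ → (∀ j : Fin k, τ a j = F j) → post τ) :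
    (mapLoop a i e f).wp M ℓ post σ := by
  have hl : (forLoop i e (.set a (.var i) f)).writes ⊆ [a, i] := by simp [forLoop, writes]
  refine wp_forLoop (fun t τ => ∀ j : Fin k, τ a j = if j < t then F j else σ a j)
    (by simpa [writes] using hai.symm) hkℓ hkM (fun τ hτ => he τ (hτ.mono hl))
    (fun t τ v h => by simpa only [write_apply_of_ne hai] using h) (by simp)
    (fun t ht τ hτ hτi hInv => ?_)
    fun τ hτ h => hpost τ (hτ.mono hl) fun j => (h j).trans (if_pos j.2)
  have hft : f.eval τ = F ⟨t, ht⟩ :=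
    hf ⟨t, ht⟩ τ (hτ.mono hl) hτi ((hInv ⟨t, ht⟩).trans (if_neg (lt_irrefl t)))
  refine wp_set (hft.trans_le (hF _)) fun j => ?_
  simp only [Expr.eval, hτi, hft, write_apply_self, Function.update_apply, hInv]
  rcases lt_trichotomy (j : ℕ) t with hj | rfl | hj
  · simp [hj, hj.ne, hj.trans (Nat.lt_succ_self t)]
  · simp
  · simp [hj.ne', hj.not_gt, show ¬(j : ℕ) < t + 1 by omega]

theorem wp_foldLoop (acc : ℕ → ℕ) (hvi : v ≠ i) (hkℓ : k ≤ ℓ) (hkM : k ≤ M)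
    (hacc : ∀ t ≤ k, acc t ≤ M) (he : ∀ τ, AgreeOff [v, i] σ τ → e.eval τ = k)
    (hf : ∀ t < k, ∀ τ, AgreeOff [v, i] σ τ → τ i 0 = t → τ v 0 = acc t → f.eval τ = acc (t + 1))
    (hpost : ∀ τ, AgreeOff [v, i] σ τ → τ v 0 = acc k → post τ) :
    (foldLoop v i (acc 0) e f).wp M ℓ post σ := by
  have hl : (forLoop i e (.assign v f)).writes ⊆ [v, i] := by simp [forLoop, writes]
  refine wp_seq (wp_assign (hacc 0 k.zero_le) fun σ' hinit hv => ?_)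
  replace hinit : AgreeOff [v, i] σ σ' := hinit.mono (by simp)
  refine wp_forLoop (fun t τ => τ v 0 = acc t) (by simpa [writes] using hvi.symm) hkℓ hkM
    (fun τ hτ => he τ (hinit.trans (hτ.mono hl)))
    (fun t τ _ h => by rwa [write_apply_of_ne hvi]) hv (fun t ht τ hτ hτi hInv => ?_)
    fun τ hτ h => hpost τ (hinit.trans (hτ.mono hl)) h
  have hft := hf t ht τ (hinit.trans (hτ.mono hl)) hτi hInv
  exact wp_assign (hft.trans_le (hacc _ ht)) fun υ _ hυ => hυ.trans hft

theorem wp_sumLoop (F : Fin k → ℕ) (hvi : v ≠ i) (hkℓ : k ≤ ℓ) (hkM : k ≤ M)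
    (hF : ∑ j, F j ≤ M) (he : ∀ τ, AgreeOff [v, i] σ τ → e.eval τ = k)
    (hf : ∀ j : Fin k, ∀ τ, AgreeOff [v, i] σ τ → τ i 0 = j → f.eval τ = F j)
    (hpost : ∀ τ, AgreeOff [v, i] σ τ → τ v 0 = ∑ j, F j → post τ) :
    (sumLoop v i e f).wp M ℓ post σ := by
  have hsum : ∑ t ∈ Finset.range k, ofFin F t = ∑ j, F j := by
    simp only [Finset.sum_range, ofFin_apply]
  rw [← hsum] at hF hpost
  refine wp_foldLoop (fun t => ∑ j ∈ Finset.range t, ofFin F j) hvi hkℓ hkM (fun t ht =>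
    (Finset.sum_le_sum_of_subset (Finset.range_subset_range.2 ht)).trans hF) he
    (fun t ht τ hτ hτi hτv => ?_) hpost
  rw [Finset.sum_range_succ, ← hτv, ← hf ⟨t, ht⟩ τ hτ hτi |>.trans (ofFin_apply ⟨t, ht⟩).symm]
  rfl

end Prog

/-! ### The algorithm and its correctness -/

/- The numbers of the arrays of the algorithm, where `0` to `3` and `6` are fixed by the input and
output conventions. Scalar variables occupy cell `0` of an array of their own. -/
namespace Arr

abbrev dims : ℕ := 0
abbrev matrix : ℕ := 1
abbrev num : ℕ := 2
abbrev den : ℕ := 3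
abbrev output : ℕ := 6
abbrev weight : ℕ := 7
abbrev load : ℕ := 8
abbrev power : ℕ := 9
abbrev chosen : ℕ := 10
abbrev best : ℕ := 11
abbrev bestWeight : ℕ := 12
abbrev bestPrice : ℕ := 13
abbrev price : ℕ := 14
abbrev blocked : ℕ := 15
abbrev value : ℕ := 16
abbrev record : ℕ := 17
abbrev commonDen : ℕ := 18
abbrev trial : ℕ := 20
abbrev round : ℕ := 21
abbrev col : ℕ := 22
abbrev row : ℕ := 23

end Arr

namespace Expr

abbrev rows : Expr := .get Arr.dims (.lit 0)
abbrev cols : Expr := .get Arr.dims (.lit 1)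
abbrev capacity : Expr := .get Arr.dims (.lit 2)

/-- The matrix entry in the current row and the column `i`. -/
abbrev entry (i : Expr) : Expr := .get Arr.matrix (.add (.mul cols (.var Arr.row)) i)

/-- The weight of the current column if it is available, and zero otherwise. -/
abbrev availableWeight : Expr :=
  .mul (.get Arr.weight (.var Arr.col)) (.mul (.sub (.lit 1) (.get Arr.chosen (.var Arr.col)))
    (.sub (.lit 1) (.var Arr.blocked)))

end Expr

namespace Prog

/-- Makes the weights integral by multiplying them with the product of their denominators. -/
def scaleProg : Prog :=
  .seq (foldLoop Arr.commonDen Arr.col 1 .cols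
      (.mul (.var Arr.commonDen) (.get Arr.den (.var Arr.col))))
    (mapLoop Arr.weight Arr.col .cols (.mul (.get Arr.num (.var Arr.col))
      (.div (.var Arr.commonDen) (.get Arr.den (.var Arr.col)))))

/-- Makes the set of chosen columns empty. -/
def resetProg : Prog :=
  .seq (mapLoop Arr.load Arr.row .rows (.lit 0))
    (.seq (mapLoop Arr.power Arr.row .rows (.lit 1)) (mapLoop Arr.chosen Arr.col .cols (.lit 0)))

/-- Computes the price of the current column. -/
def priceProg : Prog :=
  sumLoop Arr.price Arr.row .rows
    (.mul (.entry (.var Arr.col)) (.get Arr.power (.var Arr.row)))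

/-- Counts the saturated rows of the current column: `1 - (b - load)` is the indicator of
saturation. -/
def blockedProg : Prog :=
  sumLoop Arr.blocked Arr.row .rows (.mul (.entry (.var Arr.col))
    (.sub (.lit 1) (.sub .capacity (.get Arr.load (.var Arr.row)))))

/-- Replaces the stored column by the current one if that is available and has a smaller
`price / weight`. -/
def compareProg : Prog :=
  .cond (.sub (.mul .availableWeight (.var Arr.bestPrice))
      (.mul (.var Arr.bestWeight) (.var Arr.price)))
    (.seq (.assign Arr.best (.var Arr.col))
      (.seq (.assign Arr.bestWeight (.get Arr.weight (.var Arr.col)))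
        (.assign Arr.bestPrice (.var Arr.price))))
    .skip

/-- Searches the available columns for one of minimal `price / weight`. Initially the best ratio
is `1 / 0`. -/
def searchProg : Prog :=
  .seq (.assign Arr.bestWeight (.lit 0)) (.seq (.assign Arr.bestPrice (.lit 1))
    (forLoop Arr.col .cols (.seq priceProg (.seq blockedProg compareProg))))

/-- Adds the stored column to the loads of the rows. -/
def loadProg : Prog :=
  mapLoop Arr.load Arr.row .rows (.add (.get Arr.load (.var Arr.row)) (.entry (.var Arr.best)))

/-- Multiplies the power of every row that contains the stored column by `trial + 1`. -/
def powerProg : Prog :=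
  mapLoop Arr.power Arr.row .rows (.mul (.get Arr.power (.var Arr.row))
    (.add (.lit 1) (.mul (.entry (.var Arr.best)) (.var Arr.trial))))

/-- Inserts the stored column into the set of chosen columns. -/
def insertProg : Prog :=
  .seq (.set Arr.chosen (.var Arr.best) (.lit 1)) (.seq loadProg powerProg)

/-- A step of the greedy procedure. -/
def growProg : Prog := .seq searchProg (.cond (.var Arr.bestWeight) insertProg .skip)

/-- The greedy procedure with `β = trial + 1`. -/
def greedyProg : Prog := .seq resetProg (forLoop Arr.round .cols growProg)

/-- Outputs the set of chosen columns if it is heavier than the previous output. -/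
def recordProg : Prog :=
  .seq (sumLoop Arr.value Arr.col .cols
      (.mul (.get Arr.weight (.var Arr.col)) (.get Arr.chosen (.var Arr.col))))
    (.cond (.sub (.var Arr.value) (.var Arr.record))
      (.seq (.assign Arr.record (.var Arr.value))
        (mapLoop Arr.output Arr.col .cols (.get Arr.chosen (.var Arr.col))))
      .skip)

/-- The rounding algorithm. It makes no use of the random bits and of the fractional solution. -/
def mainProg : Prog :=
  .seq scaleProg (forLoop Arr.trial (.mul (.lit 8) .rows) (.seq greedyProg recordProg))

end Prog

/-- The memory holds the dimensions, the matrix and the integral weights `C`. -/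
structure Loaded {m n : ℕ} (S : Fin m → Finset (Fin n)) (b : ℕ) (C : Fin n → ℕ) (σ : Memory) :
    Prop where
  rows : σ Arr.dims 0 = m
  cols : σ Arr.dims 1 = n
  capacity : σ Arr.dims 2 = b
  matrix : ∀ (r : Fin m) (i : Fin n), σ Arr.matrix (n * r + i) = if i ∈ S r then 1 else 0
  weight : ∀ i : Fin n, σ Arr.weight i = C i

/-- The set of chosen columns is `Y`. -/
structure Represents {m n : ℕ} (S : Fin m → Finset (Fin n)) (β : ℕ) (Y : Finset (Fin n))
    (σ : Memory) : Prop where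
  chosen : ∀ i : Fin n, σ Arr.chosen i = if i ∈ Y then 1 else 0
  load : ∀ r : Fin m, σ Arr.load r = rowLoad S Y r
  power : ∀ r : Fin m, σ Arr.power r = β ^ rowLoad S Y r

/-- The resources that the algorithm needs: the bound `ℓ` for the number of iterations of a loop,
and the bound `M` for the stored numbers. -/
structure SufficientResources {n : ℕ} (m M ℓ : ℕ) (C : Fin n → ℕ) : Prop where
  trials_le : 8 * m ≤ ℓ
  cols_le : n ≤ ℓ
  iterations_le : ℓ ≤ M
  one_le : 1 ≤ M
  price_le : m * (8 * m) ^ n ≤ M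
  weight_le : ∑ i, C i ≤ M

/-- The best column among the first `t` ones is stored; `bestWeight = 0` means that there is none
available. -/
structure Searched {m n : ℕ} (S : Fin m → Finset (Fin n)) (β b : ℕ) (C : Fin n → ℕ)
    (Y : Finset (Fin n)) (t : ℕ) (σ : Memory) : Prop where
  mul_le : ∀ i : Fin n, (i : ℕ) < t → Available S b C Y i →
    C i * σ Arr.bestPrice 0 ≤ σ Arr.bestWeight 0 * price S β Y i
  price_of_none : σ Arr.bestWeight 0 = 0 → σ Arr.bestPrice 0 = 1
  eq_of_some : σ Arr.bestWeight 0 ≠ 0 → ∃ j : Fin n, σ Arr.best 0 = j ∧ Available S b C Y j ∧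
    σ Arr.bestWeight 0 = C j ∧ σ Arr.bestPrice 0 = price S β Y j

section Runs

variable {m n M ℓ b β t : ℕ} {S : Fin m → Finset (Fin n)} {C : Fin n → ℕ}
  {Y Z : Finset (Fin n)} {i j : Fin n} {σ τ : Memory} {post : Memory → Prop} {l : List ℕ}

theorem Loaded.of_agreeOff (h : Loaded S b C σ) (hστ : AgreeOff l σ τ)
    (hl : ∀ a ∈ [Arr.dims, Arr.matrix, Arr.weight], a ∉ l) : Loaded S b C τ where
  rows := by rw [hστ _ (hl _ (by simp)), h.rows]
  cols := by rw [hστ _ (hl _ (by simp)), h.cols]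
  capacity := by rw [hστ _ (hl _ (by simp)), h.capacity]
  matrix := by simpa only [hστ _ (hl Arr.matrix (by simp))] using h.matrix
  weight := by simpa only [hστ _ (hl Arr.weight (by simp))] using h.weight

theorem Represents.of_agreeOff (h : Represents S β Y σ) (hστ : AgreeOff l σ τ)
    (hl : ∀ a ∈ [Arr.chosen, Arr.load, Arr.power], a ∉ l) : Represents S β Y τ where
  chosen := by simpa only [hστ _ (hl Arr.chosen (by simp))] using h.chosen
  load := by simpa only [hστ _ (hl Arr.load (by simp))] using h.load
  power := by simpa only [hστ _ (hl Arr.power (by simp))] using h.power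

theorem Searched.of_agreeOff (h : Searched S β b C Y t σ) (hστ : AgreeOff l σ τ)
    (hl : ∀ a ∈ [Arr.best, Arr.bestWeight, Arr.bestPrice], a ∉ l) :
    Searched S β b C Y t τ where
  mul_le := by
    simpa only [hστ _ (hl Arr.bestWeight (by simp)), hστ _ (hl Arr.bestPrice (by simp))]
      using h.mul_le
  price_of_none := by
    simpa only [hστ _ (hl Arr.bestWeight (by simp)), hστ _ (hl Arr.bestPrice (by simp))]
      using h.price_of_none
  eq_of_some := by
    simpa only [hστ _ (hl Arr.best (by simp)), hστ _ (hl Arr.bestWeight (by simp)),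
      hστ _ (hl Arr.bestPrice (by simp))] using h.eq_of_some

theorem SufficientResources.rows_le (hR : SufficientResources m M ℓ C) : m ≤ ℓ := by
  linarith [hR.trials_le]

theorem eval_entry (h : Loaded S b C σ) {r : Fin m} (hr : σ Arr.row 0 = r) {e : Expr}
    (he : e.eval σ = i) : (Expr.entry e).eval σ = if i ∈ S r then 1 else 0 := by
  simp only [Expr.eval, h.cols, hr, he, h.matrix]

theorem rowLoad_le_card (r : Fin m) : rowLoad S Y r ≤ n :=
  (Finset.card_le_univ _).trans_eq (Fintype.card_fin n)

theorem pow_rowLoad_le (hβ : 1 ≤ β) (hβm : β ≤ 8 * m) (r : Fin m) :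
    β ^ rowLoad S Y r ≤ (8 * m) ^ n :=
  (pow_le_pow_left' hβm _).trans (pow_le_pow_right' (hβ.trans hβm) (rowLoad_le_card r))

theorem price_le (hβ : 1 ≤ β) (hβm : β ≤ 8 * m) : price S β Y i ≤ m * (8 * m) ^ n := by
  refine (Finset.sum_le_card_nsmul _ _ _ fun r _ => pow_rowLoad_le hβ hβm r).trans ?_
  rw [smul_eq_mul]
  gcongr
  exact (Finset.card_le_univ _).trans_eq (Fintype.card_fin m)

theorem price_eq_sum (β : ℕ) (Y : Finset (Fin n)) (i : Fin n) :
    price S β Y i = ∑ r, (if i ∈ S r then 1 else 0) * β ^ rowLoad S Y r := by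
  simp only [price, Finset.sum_filter, ite_mul, one_mul, zero_mul]

namespace Prog

theorem wp_priceProg (hR : SufficientResources m M ℓ C) (hβ : 1 ≤ β) (hβm : β ≤ 8 * m)
    (h : Loaded S b C σ) (hY : Represents S β Y σ) (hi : σ Arr.col 0 = i)
    (hpost : ∀ τ, AgreeOff [Arr.price, Arr.row] σ τ → τ Arr.price 0 = price S β Y i → post τ) :
    priceProg.wp M ℓ post σ := by
  refine wp_sumLoop (fun r => (if i ∈ S r then 1 else 0) * β ^ rowLoad S Y r) (by decide)
    hR.rows_le (hR.rows_le.trans hR.iterations_le)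
    ((price_eq_sum β Y i).symm.trans_le ((price_le hβ hβm).trans hR.price_le)) (fun τ hτ => ?_)
    (fun r τ hτ hr => ?_) fun τ hτ hprice => hpost τ hτ (hprice.trans (price_eq_sum β Y i).symm)
  · simpa only [Expr.eval, hτ Arr.dims (by decide)] using h.rows
  · have hτ' := h.of_agreeOff hτ (by decide)
    have hcol : (Expr.var Arr.col).eval τ = i := by simp [Expr.eval, hτ Arr.col, hi]
    rw [Expr.eval, eval_entry hτ' hr hcol]
    simp [Expr.eval, hτ Arr.power, hr, hY.power]

theorem wp_blockedProg (hR : SufficientResources m M ℓ C) (h : Loaded S b C σ)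
    (hY : Represents S β Y σ) (hi : σ Arr.col 0 = i)
    (hpost : ∀ τ, AgreeOff [Arr.blocked, Arr.row] σ τ →
      (τ Arr.blocked 0 = 0 ↔ ∀ r, i ∈ S r → rowLoad S Y r < b) → post τ) :
    blockedProg.wp M ℓ post σ := by
  have hrows := hR.rows_le.trans hR.iterations_le
  refine wp_sumLoop (fun r => (if i ∈ S r then 1 else 0) * (1 - (b - rowLoad S Y r)))
    (by decide) hR.rows_le hrows ?_ (fun τ hτ => ?_) (fun r τ hτ hr => ?_)
    fun τ hτ hsum => hpost τ hτ ?_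
  · refine (Finset.sum_le_card_nsmul _ _ 1 fun r _ => ?_).trans (by simpa using hrows)
    split_ifs <;> omega
  · simpa only [Expr.eval, hτ Arr.dims (by decide)] using h.rows
  · have hτ' := h.of_agreeOff hτ (by decide)
    have hcol : (Expr.var Arr.col).eval τ = i := by simp [Expr.eval, hτ Arr.col, hi]
    rw [Expr.eval, eval_entry hτ' hr hcol]
    simp [Expr.eval, hτ Arr.load, hr, hY.load, hτ'.capacity]
  · rw [hsum, Finset.sum_eq_zero_iff]
    refine forall_congr' fun r => ?_
    have hsaturated : 1 - (b - rowLoad S Y r) = 0 ↔ rowLoad S Y r < b := by omega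
    by_cases hr : i ∈ S r <;>
      simp only [hr, Finset.mem_univ, if_true, if_false, one_mul, zero_mul, hsaturated,
        forall_const, false_imp_iff]

end Prog
open Classical in
theorem eval_availableWeight (h : Loaded S b C σ) (hY : Represents S β Y σ)
    (hi : σ Arr.col 0 = i)
    (hblocked : σ Arr.blocked 0 = 0 ↔ ∀ r, i ∈ S r → rowLoad S Y r < b) :
    Expr.availableWeight.eval σ = if Available S b C Y i then C i else 0 := by
  have hsub : 1 - σ Arr.blocked 0 = if σ Arr.blocked 0 = 0 then 1 else 0 := by
    split_ifs <;> omega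
  simp only [Expr.eval, hi, h.weight, hY.chosen, Available, ← hblocked, hsub]
  by_cases hiY : i ∈ Y <;> rcases (C i).eq_zero_or_pos with hC | hC <;> simp [hiY, hC]

theorem Searched.succ_of_le (h : Searched S β b C Y i σ)
    (hle : Available S b C Y i →
      C i * σ Arr.bestPrice 0 ≤ σ Arr.bestWeight 0 * price S β Y i) :
    Searched S β b C Y (i + 1) σ where
  mul_le i' hi' := by
    rcases Nat.lt_succ_iff_lt_or_eq.1 hi' with hlt | heq
    · exact h.mul_le i' hlt
    · rwa [Fin.ext heq]
  price_of_none := h.price_of_none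
  eq_of_some := h.eq_of_some

theorem Searched.succ_of_lt (h : Searched S β b C Y i σ) (hi : Available S b C Y i)
    (hlt : σ Arr.bestWeight 0 * price S β Y i < C i * σ Arr.bestPrice 0)
    (hbest : τ Arr.best 0 = i) (hweight : τ Arr.bestWeight 0 = C i)
    (hprice : τ Arr.bestPrice 0 = price S β Y i) :
    Searched S β b C Y (i + 1) τ where
  mul_le i' hi' hav := by
    rw [hweight, hprice]
    rcases Nat.lt_succ_iff_lt_or_eq.1 hi' with hi' | hi'
    · have hpos : 0 < σ Arr.bestPrice 0 := pos_of_mul_pos_right (hlt.trans_le' zero_le) zero_le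
      refine le_of_mul_le_mul_right ?_ hpos
      calc C i' * price S β Y i * σ Arr.bestPrice 0
          = C i' * σ Arr.bestPrice 0 * price S β Y i := mul_right_comm _ _ _
        _ ≤ σ Arr.bestWeight 0 * price S β Y i' * price S β Y i :=
            Nat.mul_le_mul_right _ (h.mul_le i' hi' hav)
        _ = σ Arr.bestWeight 0 * price S β Y i * price S β Y i' := mul_right_comm _ _ _
        _ ≤ C i * σ Arr.bestPrice 0 * price S β Y i' := Nat.mul_le_mul_right _ hlt.le
        _ = C i * price S β Y i' * σ Arr.bestPrice 0 := mul_right_comm _ _ _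
    · rw [Fin.ext hi']
  price_of_none h0 := absurd (hweight.symm.trans h0) hi.1.ne'
  eq_of_some _ := ⟨i, hbest, hi, hweight, hprice⟩

theorem SufficientResources.weight_apply_le (hR : SufficientResources m M ℓ C) (i : Fin n) :
    C i ≤ M :=
  (Finset.single_le_sum (fun _ _ => zero_le) (Finset.mem_univ i)).trans hR.weight_le

namespace Prog

theorem wp_compareProg (hR : SufficientResources m M ℓ C) (hβ : 1 ≤ β) (hβm : β ≤ 8 * m)
    (h : Loaded S b C σ) (hY : Represents S β Y σ) (hi : σ Arr.col 0 = i)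
    (hprice : σ Arr.price 0 = price S β Y i)
    (hblocked : σ Arr.blocked 0 = 0 ↔ ∀ r, i ∈ S r → rowLoad S Y r < b)
    (hsearched : Searched S β b C Y i σ) :
    compareProg.wp M ℓ (Searched S β b C Y (i + 1)) σ := by
  have hweight := eval_availableWeight h hY hi hblocked
  have hcond : (Expr.sub (.mul .availableWeight (.var Arr.bestPrice))
      (.mul (.var Arr.bestWeight) (.var Arr.price))).eval σ = Expr.availableWeight.eval σ *
        σ Arr.bestPrice 0 - σ Arr.bestWeight 0 * price S β Y i := by
    rw [← hprice]; rfl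
  rw [compareProg]
  by_cases hav : Available S b C Y i
  · rw [if_pos hav] at hweight
    rw [hweight] at hcond
    refine wp_cond (fun hne => wp_seq (wp_set ?_ (wp_seq (wp_set ?_ (wp_set ?_
      (hsearched.succ_of_lt hav ?_ ?_ ?_ ?_)))))) fun heq =>
      wp_skip (hsearched.succ_of_le fun _ => ?_)
    · simpa [Expr.eval, hi] using i.2.le.trans (hR.cols_le.trans hR.iterations_le)
    · simpa [Expr.eval, write_apply_of_ne, hi, h.weight] using hR.weight_apply_le i
    · simpa [Expr.eval, write_apply_of_ne, hprice] using (price_le hβ hβm).trans hR.price_le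
    · omega
    any_goals simp [Expr.eval, write_apply_self, write_apply_of_ne, hi, h.weight, hprice]
    · omega
  · rw [if_neg hav] at hweight
    refine wp_cond (fun hne => ?_) fun _ => wp_skip (hsearched.succ_of_le fun h => absurd h hav)
    rw [hcond, hweight, zero_mul, Nat.zero_sub] at hne
    exact absurd rfl hne

theorem wp_searchProg (hR : SufficientResources m M ℓ C) (hβ : 1 ≤ β) (hβm : β ≤ 8 * m)
    (h : Loaded S b C σ) (hY : Represents S β Y σ) (hpost : ∀ τ, AgreeOff [Arr.best,
      Arr.bestWeight, Arr.bestPrice, Arr.price, Arr.blocked, Arr.col, Arr.row] σ τ →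
      Searched S β b C Y n τ → post τ) :
    searchProg.wp M ℓ post σ := by
  have hcols := hR.cols_le
  refine wp_seq (wp_assign M.zero_le fun σ₁ h₁ hw =>
    wp_seq (wp_assign hR.one_le fun σ₂ h₂ hp => ?_))
  replace hw : σ₂ Arr.bestWeight 0 = 0 := by rw [h₂ _ (by decide), hw]; rfl
  have hagree : AgreeOff [Arr.bestWeight, Arr.bestPrice] σ σ₂ :=
    (h₁.mono (by simp)).trans (h₂.mono (by simp))
  replace h := h.of_agreeOff hagree (by decide)
  replace hY := hY.of_agreeOff hagree (by decide)
  refine wp_forLoop (Searched S β b C Y) (by decide) hcols (hcols.trans hR.iterations_le)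
    (fun τ hτ => (h.of_agreeOff hτ (by decide)).cols)
    (fun t τ v h => h.of_agreeOff (agreeOff_write (List.mem_singleton_self _) _ _ _) (by decide))
    ⟨by simp, fun _ => hp, fun h => absurd hw h⟩ (fun t ht τ hτ hcol hsearched => ?_)
    fun τ hτ hsearched => hpost τ ((hagree.mono (by simp)).trans (hτ.mono (by decide))) hsearched
  have hτload := h.of_agreeOff hτ (by decide)
  have hτY := hY.of_agreeOff hτ (by decide)
  refine wp_seq (wp_priceProg (i := ⟨t, ht⟩) hR hβ hβm hτload hτY hcol fun υ hυ hprice =>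
    wp_seq (wp_blockedProg (i := ⟨t, ht⟩) hR (hτload.of_agreeOff hυ (by decide))
      (hτY.of_agreeOff hυ (by decide)) (by rw [hυ _ (by decide), hcol]) fun υ' hυ' hblocked => ?_))
  replace hυ := (hυ.mono (by simp)).trans (hυ'.mono (l' := [Arr.price, Arr.blocked, Arr.row])
    (by simp))
  exact wp_compareProg (i := ⟨t, ht⟩) hR hβ hβm (hτload.of_agreeOff hυ (by decide))
    (hτY.of_agreeOff hυ (by decide)) (by rw [hυ _ (by decide), hcol])
    (by rw [hυ' _ (by decide), hprice]) hblocked (hsearched.of_agreeOff hυ (by decide))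

end Prog

/-- `Z` is feasible and not lighter than some result of the greedy procedure, for each of the bases
`1, ..., t`. -/
structure IsBestOfTrials {R ι : Type*} [Fintype R] [DecidableEq ι] (S : R → Finset ι) (b : ℕ)
    (C : ι → ℕ) (t : ℕ) (Z : Finset ι) : Prop where
  rowLoad_le : ∀ r, rowLoad S Z r ≤ b
  exists_sum_le : ∀ β, 1 ≤ β → β ≤ t →
    ∃ Y, IsMaximalGreedy S β b C Y ∧ ∑ i ∈ Y, C i ≤ ∑ i ∈ Z, C i

/-- The output is the set `Z`, and its weight is the record. -/
structure Recorded {n : ℕ} (C : Fin n → ℕ) (Z : Finset (Fin n)) (σ : Memory) : Prop where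
  output : ∀ i : Fin n, σ Arr.output i = if i ∈ Z then 1 else 0
  record : σ Arr.record 0 = ∑ i ∈ Z, C i

theorem Recorded.of_agreeOff (h : Recorded C Z σ) (hστ : AgreeOff l σ τ)
    (hl : ∀ a ∈ [Arr.output, Arr.record], a ∉ l) : Recorded C Z τ where
  output := by simpa only [hστ _ (hl Arr.output (by simp))] using h.output
  record := by simpa only [hστ _ (hl Arr.record (by simp))] using h.record

theorem IsBestOfTrials.succ_of_le (h : IsBestOfTrials S b C t Z)
    (hY : IsMaximalGreedy S (t + 1) b C Y) (hle : ∑ i ∈ Y, C i ≤ ∑ i ∈ Z, C i) :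
    IsBestOfTrials S b C (t + 1) Z where
  rowLoad_le := h.rowLoad_le
  exists_sum_le β hβ hβt := by
    rcases Nat.le_succ_iff.1 hβt with hβt | rfl
    exacts [h.exists_sum_le β hβ hβt, ⟨Y, hY, hle⟩]

theorem IsBestOfTrials.succ_of_ge (h : IsBestOfTrials S b C t Z)
    (hY : IsMaximalGreedy S (t + 1) b C Y) (hge : ∑ i ∈ Z, C i ≤ ∑ i ∈ Y, C i) :
    IsBestOfTrials S b C (t + 1) Y where
  rowLoad_le := hY.isGreedy.rowLoad_le
  exists_sum_le β hβ hβt := by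
    rcases Nat.le_succ_iff.1 hβt with hβt | rfl
    · obtain ⟨Y', hY', hle⟩ := h.exists_sum_le β hβ hβt
      exact ⟨Y', hY', hle.trans hge⟩
    · exact ⟨Y, hY, le_rfl⟩

theorem SufficientResources.pow_rowLoad_le (hR : SufficientResources m M ℓ C) (hβ : 1 ≤ β)
    (hβm : β ≤ 8 * m) (Y : Finset (Fin n)) (r : Fin m) : β ^ rowLoad S Y r ≤ M :=
  (PackingRounding.pow_rowLoad_le hβ hβm r).trans
    ((Nat.le_mul_of_pos_left _ (by omega)).trans hR.price_le)

theorem SufficientResources.rowLoad_le (hR : SufficientResources m M ℓ C) (Y : Finset (Fin n))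
    (r : Fin m) : rowLoad S Y r ≤ M :=
  (rowLoad_le_card r).trans (hR.cols_le.trans hR.iterations_le)

namespace Prog

theorem wp_resetProg (hR : SufficientResources m M ℓ C) (h : Loaded S b C σ)
    (hpost : ∀ τ, AgreeOff [Arr.load, Arr.power, Arr.chosen, Arr.row, Arr.col] σ τ →
      Represents S β ∅ τ → post τ) : resetProg.wp M ℓ post σ := by
  have hrows := hR.rows_le.trans hR.iterations_le
  refine wp_seq (wp_mapLoop (fun _ : Fin m => 0) (by decide) hR.rows_le hrows
    (fun τ hτ => (h.of_agreeOff hτ (by decide)).rows) (fun _ _ _ _ _ => rfl)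
    (fun _ => M.zero_le) fun σ₁ h₁ hload => ?_)
  replace h := h.of_agreeOff h₁ (by decide)
  refine wp_seq (wp_mapLoop (fun _ : Fin m => 1) (by decide) hR.rows_le hrows
    (fun τ hτ => (h.of_agreeOff hτ (by decide)).rows) (fun _ _ _ _ _ => rfl)
    (fun _ => hR.one_le) fun σ₂ h₂ hpower => ?_)
  replace h := h.of_agreeOff h₂ (by decide)
  refine wp_mapLoop (fun _ : Fin n => 0) (by decide) hR.cols_le
    (hR.cols_le.trans hR.iterations_le) (fun τ hτ => (h.of_agreeOff hτ (by decide)).cols)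
    (fun _ _ _ _ _ => rfl) (fun _ => M.zero_le) fun τ hτ hchosen => hpost τ ?_ ⟨?_, ?_, ?_⟩
  · exact (h₁.mono (by simp)).trans ((h₂.mono (by simp)).trans (hτ.mono (by simp)))
  · simpa using hchosen
  · simpa [rowLoad, hτ Arr.load, h₂ Arr.load] using hload
  · simpa [rowLoad, hτ Arr.power] using hpower

theorem wp_loadProg (hR : SufficientResources m M ℓ C) (h : Loaded S b C σ)
    (hload : ∀ r : Fin m, σ Arr.load r = rowLoad S Y r) (hbest : σ Arr.best 0 = j) (hj : j ∉ Y)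
    (hpost : ∀ τ, AgreeOff [Arr.load, Arr.row] σ τ →
      (∀ r : Fin m, τ Arr.load r = rowLoad S (insert j Y) r) → post τ) :
    loadProg.wp M ℓ post σ := by
  refine wp_mapLoop (fun r => rowLoad S (insert j Y) r) (by decide) hR.rows_le
    (hR.rows_le.trans hR.iterations_le) (fun τ hτ => (h.of_agreeOff hτ (by decide)).rows)
    (fun r τ hτ hr hτr => ?_) (hR.rowLoad_le _) hpost
  have hentry := eval_entry (h.of_agreeOff hτ (by decide)) (i := j) (e := .var Arr.best) hr
    (by simp [Expr.eval, hτ Arr.best, hbest])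
  rw [Expr.eval, hentry, rowLoad_insert hj]
  simp [Expr.eval, hr, hτr, hload]

theorem wp_powerProg (hR : SufficientResources m M ℓ C) (hβ : 1 ≤ β) (hβm : β ≤ 8 * m)
    (h : Loaded S b C σ) (hpower : ∀ r : Fin m, σ Arr.power r = β ^ rowLoad S Y r)
    (hbest : σ Arr.best 0 = j) (hj : j ∉ Y) (htrial : σ Arr.trial 0 + 1 = β)
    (hpost : ∀ τ, AgreeOff [Arr.power, Arr.row] σ τ →
      (∀ r : Fin m, τ Arr.power r = β ^ rowLoad S (insert j Y) r) → post τ) :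
    powerProg.wp M ℓ post σ := by
  refine wp_mapLoop (fun r => β ^ rowLoad S (insert j Y) r) (by decide) hR.rows_le
    (hR.rows_le.trans hR.iterations_le) (fun τ hτ => (h.of_agreeOff hτ (by decide)).rows)
    (fun r τ hτ hr hτr => ?_) (hR.pow_rowLoad_le hβ hβm _) hpost
  have hentry := eval_entry (h.of_agreeOff hτ (by decide)) (i := j) (e := .var Arr.best) hr
    (by simp [Expr.eval, hτ Arr.best, hbest])
  change τ Arr.power (τ Arr.row 0) *
    (1 + (Expr.entry (.var Arr.best)).eval τ * τ Arr.trial 0) = _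
  rw [hentry, rowLoad_insert hj, hr, hτr, hpower, hτ Arr.trial (by decide)]
  subst htrial
  split_ifs <;> ring

theorem wp_insertProg (hR : SufficientResources m M ℓ C) (hβm : β ≤ 8 * m)
    (h : Loaded S b C σ) (hY : Represents S β Y σ) (htrial : σ Arr.trial 0 + 1 = β)
    (hbest : σ Arr.best 0 = j) (hj : j ∉ Y)
    (hpost : ∀ τ, Represents S β (insert j Y) τ → post τ) : insertProg.wp M ℓ post σ := by
  refine wp_seq (wp_set hR.one_le ?_)
  simp only [Expr.eval, hbest]
  have h₁ : AgreeOff [Arr.chosen] σ (write σ Arr.chosen j 1) := agreeOff_write (by simp) _ _ _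
  have hchosen : ∀ i : Fin n, write σ Arr.chosen j 1 Arr.chosen i =
      if i ∈ insert j Y then 1 else 0 := fun i => by
    simp only [write_apply_self, Function.update_apply, Fin.val_inj, hY.chosen,
      Finset.mem_insert]
    split_ifs <;> tauto
  generalize write σ Arr.chosen j 1 = σ₁ at h₁ hchosen
  replace h := h.of_agreeOff h₁ (by decide)
  refine wp_seq (wp_loadProg hR h (by simpa only [h₁ Arr.load (by decide)] using hY.load)
    (by rw [h₁ _ (by decide), hbest]) hj fun σ₂ h₂ hload => ?_)
  refine wp_powerProg hR (by omega) hβm (h.of_agreeOff h₂ (by decide))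
    (by simpa only [h₂ Arr.power (by decide), h₁ Arr.power (by decide)] using hY.power)
    (by rw [h₂ _ (by decide), h₁ _ (by decide), hbest]) hj
    (by rwa [h₂ _ (by decide), h₁ _ (by decide)]) fun τ hτ hpower => hpost τ ⟨?_, ?_, hpower⟩
  · simpa only [hτ Arr.chosen (by decide), h₂ Arr.chosen (by decide)] using hchosen
  · simpa only [hτ Arr.load (by decide)] using hload

theorem wp_growProg (hR : SufficientResources m M ℓ C) (hβm : β ≤ 8 * m)
    (h : Loaded S b C σ) (hY : Represents S β Y σ) (htrial : σ Arr.trial 0 + 1 = β)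
    (hskip : (∀ i, ¬Available S b C Y i) → ∀ τ, Represents S β Y τ → post τ)
    (hinsert : ∀ j, Available S b C Y j →
      (∀ i, Available S b C Y i → C i * price S β Y j ≤ C j * price S β Y i) →
      ∀ τ, Represents S β (insert j Y) τ → post τ) :
    growProg.wp M ℓ post σ := by
  refine wp_seq (wp_searchProg hR (by omega) hβm h hY fun τ hτ hsearched => ?_)
  replace hY := hY.of_agreeOff hτ (by decide)
  refine wp_cond (fun hne => ?_) fun heq => wp_skip (hskip (fun i hi => ?_) τ hY)
  · obtain ⟨j, hbest, hj, hweight, hprice⟩ := hsearched.eq_of_some hne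
    refine wp_insertProg hR hβm (h.of_agreeOff hτ (by decide)) hY
      (by rwa [hτ _ (by decide)]) hbest hj.2.1 (hinsert j hj fun i hi => ?_)
    simpa only [hweight, hprice] using hsearched.mul_le i i.2 hi
  · have hle := hsearched.mul_le i i.2 hi
    rw [hsearched.price_of_none heq, show τ Arr.bestWeight 0 = 0 from heq] at hle
    have := hi.1
    omega

theorem wp_greedyProg (hR : SufficientResources m M ℓ C) (hβm : β ≤ 8 * m)
    (h : Loaded S b C σ) (htrial : σ Arr.trial 0 + 1 = β) :
    greedyProg.wp M ℓ (fun τ => ∃ Y, IsMaximalGreedy S β b C Y ∧ Represents S β Y τ) σ := by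
  refine wp_seq (wp_resetProg (β := β) hR h fun σ₁ h₁ hY₁ => ?_)
  replace h := h.of_agreeOff h₁ (by decide)
  replace htrial : σ₁ Arr.trial 0 + 1 = β := by rwa [h₁ _ (by decide)]
  refine wp_forLoop (fun t τ => ∃ Y, IsGreedy S β b C Y ∧ Represents S β Y τ ∧
      (t ≤ Y.card ∨ ∀ i, ¬Available S b C Y i)) (by decide) hR.cols_le
    (hR.cols_le.trans hR.iterations_le) (fun τ hτ => (h.of_agreeOff hτ (by decide)).cols) ?_
    ⟨∅, .empty, hY₁, .inl (Nat.zero_le _)⟩ ?_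
    fun τ _ ⟨Y, hgreedy, hY, hend⟩ => ⟨Y, ⟨hgreedy, ?_⟩, hY⟩
  · rintro t τ v ⟨Y, hgreedy, hY, hend⟩
    exact ⟨Y, hgreedy, hY.of_agreeOff (agreeOff_write (List.mem_singleton_self _) _ _ _)
      (by decide), hend⟩
  · rintro t - τ hτ - ⟨Y, hgreedy, hY, hend⟩
    refine wp_growProg hR hβm (h.of_agreeOff hτ (by decide)) hY (by rwa [hτ _ (by decide)])
      (fun hav υ hυ => ⟨Y, hgreedy, hυ, .inr hav⟩)
      fun j hj hmin υ hυ => ⟨insert j Y, hgreedy.insert hj hmin, hυ, .inl ?_⟩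
    rw [Finset.card_insert_of_notMem hj.2.1]
    exact Nat.succ_le_succ (hend.resolve_right fun hav => hav j hj)
  · refine hend.elim (fun hcard i hi => hi.2.1 ?_) id
    rw [(Finset.card_eq_iff_eq_univ Y).1
      ((Finset.card_le_univ Y).antisymm (by simpa using hcard))]
    exact Finset.mem_univ i

theorem wp_recordProg (hR : SufficientResources m M ℓ C) (h : Loaded S b C σ)
    (hY : Represents S β Y σ) (hZ : Recorded C Z σ) :
    recordProg.wp M ℓ (fun τ => ∑ i ∈ Y, C i ≤ ∑ i ∈ Z, C i ∧ Recorded C Z τ ∨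
      ∑ i ∈ Z, C i ≤ ∑ i ∈ Y, C i ∧ Recorded C Y τ) σ := by
  have hcols := hR.cols_le.trans hR.iterations_le
  have hsum : ∑ i, C i * (if i ∈ Y then 1 else 0) = ∑ i ∈ Y, C i := by simp
  have hsum_le : ∑ i ∈ Y, C i ≤ M :=
    (Finset.sum_le_univ_sum_of_nonneg fun _ => zero_le).trans hR.weight_le
  refine wp_seq (wp_sumLoop (fun i => C i * (if i ∈ Y then 1 else 0)) (by decide) hR.cols_le hcols
    (hsum.trans_le hsum_le) (fun τ hτ => (h.of_agreeOff hτ (by decide)).cols)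
    (fun i τ hτ hi => ?_) fun σ₁ h₁ hvalue => ?_)
  · have hτY := hY.of_agreeOff hτ (by decide)
    simp only [Expr.eval, hi, (h.of_agreeOff hτ (by decide)).weight, hτY.chosen]
  rw [hsum] at hvalue
  have hrecord := hZ.record
  rw [← h₁ _ (by decide)] at hrecord
  refine wp_cond (fun hne => ?_) fun heq => wp_skip (.inl ⟨?_, hZ.of_agreeOff h₁ (by decide)⟩)
  · simp only [Expr.eval, hvalue, hrecord] at hne
    refine wp_seq (wp_assign (by simpa only [Expr.eval, hvalue] using hsum_le) fun σ₂ h₂ hassign =>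
      wp_mapLoop (fun i => if i ∈ Y then 1 else 0) (by decide) hR.cols_le hcols
        (fun τ hτ => ?_) (fun i τ hτ hi _ => ?_) (fun i => ?_)
        fun τ hτ houtput => .inr ⟨by omega, houtput, ?_⟩)
    · exact (((h.of_agreeOff h₁ (by decide)).of_agreeOff h₂ (by decide)).of_agreeOff hτ
        (by decide)).cols
    · simp only [Expr.eval, hi, hτ Arr.chosen (by decide), h₂ Arr.chosen (by decide),
        h₁ Arr.chosen (by decide), hY.chosen]
    · split_ifs
      exacts [hR.one_le, M.zero_le]
    · rw [hτ _ (by decide), hassign, ← hvalue]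
      rfl
  · simpa only [Expr.eval, hvalue, hrecord, Nat.sub_eq_zero_iff_le] using heq

end Prog

end Runs

theorem prod_le_two_pow {ι : Type*} [Fintype ι] {v : ι → ℕ} {L : ℕ} (h : ∑ i, (v i).size ≤ L) :
    ∏ i, v i ≤ 2 ^ L :=
  calc ∏ i, v i ≤ ∏ i, 2 ^ (v i).size := Finset.prod_le_prod' fun i _ => (Nat.lt_size_self _).le
    _ = 2 ^ ∑ i, (v i).size := Finset.prod_pow_eq_pow_sum _ _ _
    _ ≤ 2 ^ L := by gcongr; norm_num

theorem prod_range_ofFin {n : ℕ} (v : Fin n → ℕ) :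
    ∏ j ∈ Finset.range n, ofFin v j = ∏ i, v i := by
  simp only [Finset.prod_range, ofFin_apply]

theorem ofFin_le {n M : ℕ} {v : Fin n → ℕ} (hv : ∀ i, v i ≤ M) (i : ℕ) : ofFin v i ≤ M := by
  unfold ofFin
  split_ifs
  exacts [hv _, M.zero_le]

namespace Input

variable {m n : ℕ} (I : Input m n)

/-- A common denominator of the weights. -/
def commonDen : ℕ := ∏ i, (I.c i).den

/-- The weights multiplied by the common denominator. -/
def intWeight (i : Fin n) : ℕ := (I.c i).num * (I.commonDen / (I.c i).den)

theorem commonDen_pos : 0 < I.commonDen := Finset.prod_pos fun i _ => (I.c i).den_pos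

theorem intWeight_cast (i : Fin n) : (I.intWeight i : ℝ) = I.commonDen * (I.c i : ℝ) := by
  have hdvd : (I.c i).den ∣ I.commonDen := Finset.dvd_prod_of_mem _ (Finset.mem_univ i)
  have hne : ((I.c i).den : ℝ) ≠ 0 := by exact_mod_cast (I.c i).den_ne_zero
  rw [intWeight, Nat.cast_mul, Nat.cast_div hdvd hne, NNRat.cast_def]
  ring

theorem rows_add_cols_le_length : m + n ≤ I.length := by
  unfold length
  omega

theorem sum_size_le_length :
    (∑ i, (I.c i).num.size ≤ I.length ∧ ∑ i, (I.c i).den.size ≤ I.length) ∧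
      ∑ i, (I.x i).num.size ≤ I.length ∧ ∑ i, (I.x i).den.size ≤ I.length := by
  simp only [length, Finset.sum_add_distrib]
  omega

theorem commonDen_le : I.commonDen ≤ 2 ^ I.length := prod_le_two_pow I.sum_size_le_length.1.2

theorem sum_intWeight_le : ∑ i, I.intWeight i ≤ 2 ^ (3 * I.length) := by
  have hnum : ∀ i, (I.c i).num ≤ 2 ^ I.length := fun i =>
    (Nat.size_le.1 ((Finset.single_le_sum (f := fun i => (I.c i).num.size) (fun _ _ => zero_le)
      (Finset.mem_univ i)).trans I.sum_size_le_length.1.1)).le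
  have hn : n ≤ 2 ^ I.length :=
    ((Nat.le_add_left _ _).trans I.rows_add_cols_le_length).trans Nat.lt_two_pow_self.le
  calc ∑ i, I.intWeight i ≤ ∑ _i : Fin n, 2 ^ I.length * 2 ^ I.length := by
        unfold intWeight
        gcongr with i
        exacts [hnum i, (Nat.div_le_self _ _).trans I.commonDen_le]
    _ = n * (2 ^ I.length * 2 ^ I.length) := by simp
    _ ≤ 2 ^ I.length * (2 ^ I.length * 2 ^ I.length) := by gcongr
    _ = 2 ^ (3 * I.length) := by ring

/-- A bound for the numbers that the algorithm stores. -/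
def maxEntry : ℕ := 2 ^ ((I.length + 3) * (I.length + 1))

theorem bounded_load : Bounded I.maxEntry I.load := by
  obtain ⟨⟨hcnum, hcden⟩, hxnum, hxden⟩ := I.sum_size_le_length
  have hpow : 2 ^ I.length ≤ I.maxEntry := Nat.pow_le_pow_right two_pos (by nlinarith)
  have hvec : ∀ v : Fin n → ℕ, ∑ i, (v i).size ≤ I.length → ∀ i, ofFin v i ≤ I.maxEntry :=
    fun v hv => ofFin_le fun i => le_trans (Nat.size_le.1 ((Finset.single_le_sum
      (f := fun i => (v i).size) (fun _ _ => zero_le) (Finset.mem_univ i)).trans hv)).le hpow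
  have hmn := I.rows_add_cols_le_length
  have hlength := (Nat.lt_two_pow_self (n := I.length)).le.trans hpow
  have hb : I.b ≤ I.maxEntry :=
    (Nat.size_le.1 (show I.b.size ≤ I.length by unfold length; omega)).le.trans hpow
  intro a i
  match a with
  | 0 =>
    refine ofFin_le (fun j => ?_) i
    fin_cases j
    exacts [by simp; omega, by simp; omega, hb]
  | 1 =>
    unfold load
    refine ofFin_le (fun j => ?_) i
    split_ifs
    exacts [Nat.one_le_two_pow, zero_le]
  | 2 => exact hvec _ hcnum i
  | 3 => exact hvec _ hcden i
  | 4 => exact hvec _ hxnum i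
  | 5 => exact hvec _ hxden i
  | _ + 6 => exact zero_le

theorem sufficientResources :
    SufficientResources m I.maxEntry (8 * I.length) I.intWeight where
  trials_le := by linarith [I.rows_add_cols_le_length]
  cols_le := by linarith [I.rows_add_cols_le_length]
  iterations_le := calc
    8 * I.length ≤ 2 ^ 3 * 2 ^ I.length := Nat.mul_le_mul_left _ Nat.lt_two_pow_self.le
    _ = 2 ^ (3 + I.length) := (pow_add _ _ _).symm
    _ ≤ I.maxEntry := Nat.pow_le_pow_right two_pos (by nlinarith)
  one_le := Nat.one_le_two_pow
  price_le := by
    have hmn := I.rows_add_cols_le_length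
    have hm : m ≤ 2 ^ I.length := le_trans (by omega) Nat.lt_two_pow_self.le
    calc m * (8 * m) ^ n ≤ 2 ^ I.length * (2 ^ 3 * 2 ^ I.length) ^ n := by gcongr; norm_num
      _ ≤ 2 ^ I.length * (2 ^ 3 * 2 ^ I.length) ^ I.length := by
        gcongr
        exacts [Nat.one_le_iff_ne_zero.2 (by positivity), by omega]
      _ = 2 ^ (I.length + (3 + I.length) * I.length) := by rw [← pow_add, ← pow_mul, ← pow_add]
      _ ≤ I.maxEntry := Nat.pow_le_pow_right two_pos (by nlinarith)
  weight_le := I.sum_intWeight_le.trans (Nat.pow_le_pow_right two_pos (by nlinarith))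

theorem load_matrix (r : Fin m) (i : Fin n) :
    I.load Arr.matrix (n * r + i) = if i ∈ I.supp r then 1 else 0 := by
  have h : n * (r : ℕ) + i = (finProdFinEquiv (r, i) : Fin (m * n)) := by
    simp [finProdFinEquiv, add_comm]
  rw [h]
  simp only [load, ofFin_apply, Equiv.symm_apply_apply]

end Input

namespace Prog

variable {m n : ℕ} (I : Input m n)

theorem wp_scaleProg : scaleProg.wp I.maxEntry (8 * I.length)
    (fun τ => Loaded I.supp I.b I.intWeight τ ∧ Recorded I.intWeight ∅ τ) I.load := by
  have hR := I.sufficientResources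
  have hcols := hR.cols_le.trans hR.iterations_le
  have hmem : ∀ j ∈ Finset.range n, 1 ≤ ofFin (fun i => (I.c i).den) j := fun j hj =>
    (ofFin_apply ⟨j, Finset.mem_range.1 hj⟩).trans_ge (I.c _).den_pos
  have hden : I.commonDen ≤ I.maxEntry :=
    I.commonDen_le.trans (Nat.pow_le_pow_right two_pos (by nlinarith))
  refine wp_seq (wp_foldLoop (k := n)
    (fun t => ∏ j ∈ Finset.range t, ofFin (fun i => (I.c i).den) j) (by decide) hR.cols_le hcols
    (fun t ht => le_trans ?_ hden) (fun τ hτ => by simp [Expr.eval, hτ Arr.dims, Input.load, ofFin])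
    (fun t _ τ hτ hτi hacc => ?_) fun σ₁ h₁ hcommonDen => ?_)
  · rw [Input.commonDen, ← prod_range_ofFin]
    exact Finset.prod_le_prod_of_subset_of_one_le' (Finset.range_subset_range.2 ht)
      fun j hj _ => hmem j hj
  · change τ Arr.commonDen 0 * τ Arr.den (τ Arr.col 0) = _
    rw [Finset.prod_range_succ, hacc, hτi, hτ Arr.den (by decide)]
    rfl
  rw [prod_range_ofFin] at hcommonDen
  refine wp_mapLoop I.intWeight (by decide) hR.cols_le hcols
    (fun τ hτ => ?_) (fun i τ hτ hi _ => ?_)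
    (fun i => hR.weight_apply_le i) fun τ hτ hweight => ?_
  all_goals have hload : AgreeOff [Arr.weight, Arr.commonDen, Arr.col] I.load τ :=
    (h₁.mono (by simp)).trans (hτ.mono (by simp))
  · simp [Expr.eval, hload Arr.dims, Input.load, ofFin]
  · simp only [Expr.eval, hi, hload Arr.num (by decide), hload Arr.den (by decide),
      hτ Arr.commonDen (by decide), hcommonDen, Input.load, ofFin_apply]
    rfl
  · refine ⟨⟨?_, ?_, ?_, ?_, hweight⟩, ⟨?_, ?_⟩⟩
    case refine_4 => simpa only [hload Arr.matrix (by decide)] using I.load_matrix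
    all_goals simp [hload Arr.dims, hload Arr.output, hload Arr.record, Input.load, ofFin]

theorem wp_mainProg : mainProg.wp I.maxEntry (8 * I.length)
    (fun τ => ∃ Z, IsBestOfTrials I.supp I.b I.intWeight (8 * m) Z ∧
      Recorded I.intWeight Z τ) I.load := by
  have hR := I.sufficientResources
  refine wp_seq ((wp_scaleProg I).mono fun σ ⟨h, hrecorded⟩ => ?_)
  refine wp_forLoop (fun t τ => ∃ Z, IsBestOfTrials I.supp I.b I.intWeight t Z ∧
      Recorded I.intWeight Z τ) (by decide) hR.trials_le (hR.trials_le.trans hR.iterations_le)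
    (fun τ hτ => ?_) ?_ ⟨∅, ⟨by simp [rowLoad], by omega⟩, hrecorded⟩ ?_ fun τ _ h => h
  · simp [Expr.eval, (h.of_agreeOff hτ (by decide)).rows]
  · rintro t τ v ⟨Z, hbest, hZ⟩
    exact ⟨Z, hbest, hZ.of_agreeOff (agreeOff_write (List.mem_singleton_self _) _ _ _) (by decide)⟩
  rintro t ht τ hτ htrial ⟨Z, hbest, hZ⟩
  replace h := h.of_agreeOff hτ (by decide)
  refine wp_seq ((wp_greedyProg hR (β := t + 1) ht h (by rw [htrial])).frame.mono ?_)
  rintro υ ⟨hυ, Y, hgreedy, hY⟩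
  refine (wp_recordProg hR (h.of_agreeOff hυ (by decide)) hY
    (hZ.of_agreeOff hυ (by decide))).mono fun τ' => ?_
  rintro (⟨hle, hrec⟩ | ⟨hle, hrec⟩)
  exacts [⟨Z, hbest.succ_of_le hgreedy hle, hrec⟩, ⟨Y, hbest.succ_of_ge hgreedy hle, hrec⟩]

end Prog

/-- A bound for the running time of the algorithm in terms of the length of the input. -/
noncomputable def timeBound : Polynomial ℕ :=
  Prog.mainProg.costBound ((.X + 3) * (.X + 1) + 1) (8 * .X)

theorem RunsTo.mono {m n T : ℕ} {P : Prog} {I : Input m n} {ω : ℕ → Bool}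
    {G G' : (Fin n → ℝ) → Prop} (h : RunsTo P I T ω G) (hG : ∀ y, G y → G' y) :
    RunsTo P I T ω G' :=
  let ⟨s, t, hexec, ht, hs⟩ := h
  ⟨s, t, hexec, ht, hG _ hs⟩

theorem Input.exists_runsTo_mainProg {m n : ℕ} (I : Input m n) :
    ∃ Z, IsBestOfTrials I.supp I.b I.intWeight (8 * m) Z ∧
      ∀ ω, RunsTo .mainProg I (timeBound.eval I.length) ω
        (· = fun i => if i ∈ Z then 1 else 0) := by
  obtain ⟨τ, -, ⟨Z, hbest, hZ⟩, hrun⟩ := Prog.wp_mainProg I I.bounded_load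
  refine ⟨Z, hbest, fun ω => ?_⟩
  obtain ⟨t, ht, hexec⟩ := hrun ω 0
  refine ⟨_, t, hexec, ht.trans_eq ?_, funext fun i => ?_⟩
  · simp [timeBound, Prog.eval_costBound, Input.maxEntry, Nat.size_pow]
  · simpa [State.output] using congrArg (Nat.cast (R := ℝ)) (hZ.output i)

theorem runsInTime_mainProg : RunsInTime .mainProg timeBound := fun _ _ I ω =>
  let ⟨_, _, hrun⟩ := I.exists_runsTo_mainProg
  (hrun ω).mono fun _ _ => trivial

section Rounding

variable {m n k b : ℕ} {S : Fin m → Finset (Fin n)} {p d : ℝ}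

theorem IsLPOptimal.exists_isRoundingWithin {c x : Fin n → ℝ} (hm : 1 ≤ m) (hb : b ≠ 0)
    (hS : ∀ r, (S r).card ≤ k) (hp : 1 ≤ p) (hd : 1 ≤ d) (hmk : (m * k : ℝ) ≤ d * n)
    (hc : ∀ i, 1 / p ≤ c i ∧ c i ≤ 1) (h : IsLPOptimal (zeroOneMatrix S) b c x) :
    ∃ y, IsRoundingWithin (36 * min (m : ℝ) (p * d) ^ (1 / b : ℝ)) (zeroOneMatrix S) b c x y := by
  obtain ⟨β, -, -, hβ⟩ := h.exists_base_forall_isMaximalGreedy hm hb hS hp hd hmk hc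
  obtain ⟨Y, hY⟩ := exists_isMaximalGreedy S (β : ℝ) b c
  exact ⟨_, isRoundingWithin_indicator hY.isGreedy.rowLoad_le (hβ Y hY)⟩

theorem IsBestOfTrials.isRoundingWithin {I : Input m n} {Z : Finset (Fin n)}
    (hZ : IsBestOfTrials I.supp I.b I.intWeight (8 * m) Z) (hm : 1 ≤ m) (hb : I.b ≠ 0)
    (hS : ∀ r, (I.supp r).card ≤ k) (hp : 1 ≤ p) (hd : 1 ≤ d) (hmk : (m * k : ℝ) ≤ d * n)
    (hc : ∀ i, 1 / p ≤ (I.c i : ℝ) ∧ (I.c i : ℝ) ≤ 1)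
    (h : IsLPOptimal (zeroOneMatrix I.supp) I.b (fun i => (I.c i : ℝ)) fun i => (I.x i : ℝ)) :
    IsRoundingWithin (36 * min (m : ℝ) (p * d) ^ (1 / I.b : ℝ)) (zeroOneMatrix I.supp) I.b
      (fun i => (I.c i : ℝ)) (fun i => (I.x i : ℝ)) fun i => if i ∈ Z then 1 else 0 := by
  obtain ⟨β, hβ, hβm, hround⟩ := h.exists_base_forall_isMaximalGreedy hm hb hS hp hd hmk hc
  obtain ⟨Y, hY, hle⟩ := hZ.exists_sum_le β hβ hβm
  have hD : (0 : ℝ) < I.commonDen := Nat.cast_pos.2 I.commonDen_pos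
  have hsum_le : ∑ i ∈ Y, (I.c i : ℝ) ≤ ∑ i ∈ Z, (I.c i : ℝ) := by
    refine le_of_mul_le_mul_left ?_ hD
    simp only [Finset.mul_sum, ← I.intWeight_cast]
    exact_mod_cast hle
  refine isRoundingWithin_indicator hZ.rowLoad_le
    ((hround Y (hY.of_natCast_eq_mul hD I.intWeight_cast)).trans ?_)
  gcongr

theorem IsRoundingWithin.isGoodRounding {γ ρ : ℝ} {A : Matrix (Fin m) (Fin n) ℝ}
    {c x y : Fin n → ℝ} (h : IsRoundingWithin ρ A b c x y) (hγ : 0 ≤ γ) (hc : ∀ i, 0 ≤ c i)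
    (hρ : γ * ρ ≤ approxFactor m b p) : IsGoodRounding γ A b p c x y := by
  obtain ⟨hy, hA, hobj⟩ := h
  have hcy : 0 ≤ c ⬝ᵥ y := Finset.sum_nonneg fun i _ =>
    mul_nonneg (hc i) ((hy i).elim Eq.ge fun hi => hi ▸ zero_le_one)
  have hfactor : 0 ≤ approxFactor m b p :=
    Real.rpow_nonneg ((sq_nonneg _).trans (le_max_right _ _)) _
  refine ⟨hy, hA, ?_⟩
  rw [mul_div_assoc']
  refine div_le_of_le_mul₀ hfactor hcy ?_
  calc γ * (c ⬝ᵥ x) ≤ γ * (ρ * (c ⬝ᵥ y)) := mul_le_mul_of_nonneg_left hobj hγ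
    _ = γ * ρ * (c ⬝ᵥ y) := (mul_assoc _ _ _).symm
    _ ≤ c ⬝ᵥ y * approxFactor m b p := by
      rw [mul_comm (c ⬝ᵥ y)]
      exact mul_le_mul_of_nonneg_right hρ hcy

theorem min_rpow_le_approxFactor (m b : ℕ) (hp : 1 ≤ p) (hlog : 1 ≤ Real.logb 2 m) :
    min (m : ℝ) (p * Real.logb 2 m) ^ (1 / b : ℝ) ≤ approxFactor m b p := by
  unfold approxFactor
  gcongr
  exact (min_le_right _ _).trans (le_max_left _ _)

end Rounding

theorem one_sub_le_uniformProb {Ω : Type} [Fintype Ω] [Nonempty Ω] {E : Ω → Prop} {ε : ℝ}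
    (hε : 0 ≤ ε) (h : ∀ x, E x) : 1 - ε ≤ uniformProb E := by
  have hcard : (Fintype.card Ω : ℝ) ≠ 0 := by exact_mod_cast Fintype.card_ne_zero
  simpa [uniformProb, h, hcard] using hε

theorem RowChoice.nonempty {m n k : ℕ} (hkn : k ≤ n) : Nonempty (RowChoice m n k) :=
  let ⟨s, _, hs⟩ := Finset.exists_subset_card_eq (s := (Finset.univ : Finset (Fin n)))
    (n := k) (by simpa using hkn)
  ⟨fun _ => ⟨s, hs⟩⟩

theorem one_le_logb_of_le_div {m n k : ℕ} (hm : 1 ≤ m) (h : (m : ℝ) ≤ n * Real.logb 2 m / k) :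
    1 ≤ Real.logb 2 m := by
  have hm₂ : 2 ≤ m := by
    by_contra hlt
    obtain rfl : m = 1 := by omega
    norm_num at h
  rw [Real.le_logb_iff_rpow_le one_lt_two (by positivity)]
  simpa using mod_cast hm₂

end PackingRounding

open PackingRounding in
theorem mainTheorem2_general :
    ∃ (P : Prog) (q : Polynomial ℕ), RunsInTime P q ∧
      ∀ (m n k b : ℕ) (d : ℝ) (S : Fin m → Finset (Fin n)), 1 ≤ m → 1 ≤ b → 1 ≤ d →
        (∀ r, (S r).card ≤ k) → (m * k : ℝ) ≤ d * n →
          (∀ (p : ℝ) (c x : Fin n → ℝ), 1 ≤ p → (∀ i, 1 / p ≤ c i ∧ c i ≤ 1) →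
            IsLPOptimal (zeroOneMatrix S) b c x →
            ∃ y, IsRoundingWithin (36 * min (m : ℝ) (p * d) ^ (1 / b : ℝ)) (zeroOneMatrix S) b
              c x y) ∧
          (∀ (p : ℝ) (c x : Fin n → ℚ≥0), 1 ≤ p → (∀ i, 1 / p ≤ (c i : ℝ) ∧ (c i : ℝ) ≤ 1) →
            IsLPOptimal (zeroOneMatrix S) b (fun i => (c i : ℝ)) (fun i => (x i : ℝ)) →
            ∀ ω, RunsTo P ⟨S, b, c, x⟩ (q.eval (Input.length ⟨S, b, c, x⟩)) ω
              (IsRoundingWithin (36 * min (m : ℝ) (p * d) ^ (1 / b : ℝ)) (zeroOneMatrix S) b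
                (fun i => (c i : ℝ)) (fun i => (x i : ℝ)))) := by
  refine ⟨.mainProg, timeBound, runsInTime_mainProg, fun m n k b d S hm hb hd hS hmk =>
    ⟨fun p c x hp hc h =>
        h.exists_isRoundingWithin hm (Nat.one_le_iff_ne_zero.1 hb) hS hp hd hmk hc,
      fun p c x hp hc h ω => ?_⟩⟩
  obtain ⟨Z, hZ, hrun⟩ := (⟨S, b, c, x⟩ : Input m n).exists_runsTo_mainProg
  refine (hrun ω).mono ?_
  rintro _ rfl
  exact hZ.isRoundingWithin hm (Nat.one_le_iff_ne_zero.1 hb) hS hp hd hmk hc h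

open PackingRounding in
theorem mainTheorem2 :
    ∃ γ : ℝ, 0 < γ ∧ ∀ a : ℕ, ∃ (P : Prog) (q : Polynomial ℕ), RunsInTime P q ∧
      ∀ m n k b : ℕ, 1 ≤ m → 1 ≤ k → k ≤ n → 1 ≤ b →
        (m : ℝ) ≤ n * Real.logb 2 m / k →
        1 - 1 / (m : ℝ) ^ a ≤ uniformProb fun R : RowChoice m n k =>
          -- every optimal solution, with arbitrary real data, has a good rounding
          (∀ (p : ℝ) (c x : Fin n → ℝ), 1 ≤ p → (∀ i, 1 / p ≤ c i ∧ c i ≤ 1) →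
            IsLPOptimal (zeroOneMatrix R.supports) b c x →
            ∃ y, IsGoodRounding γ (zeroOneMatrix R.supports) b p c x y) ∧
          -- for rational data, the program finds one in polynomial time with high probability
          (∀ (p : ℝ) (c x : Fin n → ℚ≥0), 1 ≤ p → (∀ i, 1 / p ≤ (c i : ℝ) ∧ (c i : ℝ) ≤ 1) →
            IsLPOptimal (zeroOneMatrix R.supports) b (fun i => (c i : ℝ)) (fun i => (x i : ℝ)) →
            1 - 1 / (m : ℝ) ^ a ≤ uniformProb fun
              r : Fin (q.eval (Input.length ⟨R.supports, b, c, x⟩)) → Bool =>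
                RunsTo P ⟨R.supports, b, c, x⟩ (q.eval (Input.length ⟨R.supports, b, c, x⟩))
                  (coins r)
                  (IsGoodRounding γ (zeroOneMatrix R.supports) b p
                    (fun i => (c i : ℝ)) (fun i => (x i : ℝ)))) := by
  obtain ⟨P, q, htime, hround⟩ := mainTheorem2_general
  refine ⟨1 / 36, by norm_num, fun a => ⟨P, q, htime, fun m n k b hm hk hkn hb hmk => ?_⟩⟩
  have := RowChoice.nonempty (m := m) hkn
  have hlog := one_le_logb_of_le_div hm hmk
  rw [le_div_iff₀ (by exact_mod_cast hk), mul_comm (n : ℝ)] at hmk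
  have hgood {p : ℝ} {A : Matrix (Fin m) (Fin n) ℝ} {c x y : Fin n → ℝ} (hp : 1 ≤ p)
      (hc : ∀ i, 1 / p ≤ c i ∧ c i ≤ 1) (hy : IsRoundingWithin
        (36 * min (m : ℝ) (p * Real.logb 2 m) ^ (1 / b : ℝ)) A b c x y) :
      IsGoodRounding (1 / 36) A b p c x y :=
    hy.isGoodRounding (by norm_num) (fun i => le_trans (by positivity) (hc i).1)
      (by linarith [min_rpow_le_approxFactor m b hp hlog])
  refine one_sub_le_uniformProb (by positivity) fun R => ?_
  obtain ⟨hex, hrun⟩ := hround m n k b _ R.supports hm hb hlog (fun r => (R r).2.le) hmk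
  exact ⟨fun p c x hp hc h => (hex p c x hp hc h).imp fun _ => hgood hp hc,
    fun p c x hp hc h => one_sub_le_uniformProb (by positivity) fun r =>
      (hrun p c x hp hc h _).mono fun _ => hgood hp hc⟩
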